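/- **Setting.** Let $G$ be a finite simple graph on the index set $V$, $|V|=p$, with connected components (groups) $\mathcal C_1,\dots,\mathcal C_k$, $T_j=|\mathcal C_j|$, $T_{\max}=\max_j T_j$, $T_{\min}=\min_j T_j$, and Laplacian $L=D-A$. For $\beta\in\mathbb R^p$ let $\beta^j$ be its restriction to $\mathcal C_j$, let $A(\beta)=\{j:\|\beta^j\|_2\ne 0\}$, and for $t\ge 0$ let $\Lambda_t(\beta)=\sum_{i}\sqrt{|(e^{-tL}(\beta\odot\beta))_i|}$. Let $y=X\beta^*+\varepsilon$, where $X\in\mathbb R^{n\times p}$ is fixed and $\varepsilon$ has i.i.d. $N(0,\sigma^2)$ coordinates. For $\lambda>0$ put $F_{t,\lambda}(\beta)=\frac1{2n}\|y-X\beta\|_2^2+\lambda\Lambda_t(\beta)$, and for $\epsilon>0$ put $B[\beta^*;\epsilon]=\{\beta: n^{-1/2}\|X(\beta-\beta^*)\|_2\le\epsilon\}$. Let $\Psi[j,j']=\frac1n X_j^\top X_{j'}$, where $X_j$ consists of the columns of $X$ in $\mathcal C_j$, enumerated in some fixed order by $1,\dots,T_j$, and for $\eta\in(0,1)$ let $$\Lambda(X;\eta)=\max_{1\le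 j\le k}\sqrt{\|\Psi[j,j]\|_{\mathrm{op}}}\Big(1+\sqrt{4\log(\eta^{-1})/T_j}\Big).$$ A matrix $M$ with $p$ columns satisfies $\mathrm{RE}_\gamma(s,\kappa)$ if $\|M\Delta\|_2\ge\kappa\big(\sum_{j\in A}\|\Delta^j\|_2^2\big)^{1/2}$ for all $A\subseteq\{1,\dots,k\}$ with $|A|\le s$ and all $\Delta\neq 0$ with $\sum_{j\notin A}\sqrt{T_j}\|\Delta^j\|_2\le\gamma\sum_{j\in A}\sqrt{T_j}\|\Delta^j\|_2$. **Theorem 2 (Support recovery).** For every $G$ and every $\alpha>1$ there is $t_0$ (depending only on $G$ and $\alpha$) such that the following holds for all $t\ge t_0$. Let $\eta\in(0,1)$, $\lambda>0$, $\lambda\ge\frac{2\sigma}{\sqrt n}\Lambda(X;\eta)$, $\epsilon>0$. Let $s\ge1$ be an integer with $s\ge|A(\beta^*)|$, and suppose that $X/\sqrt n$ satisfies $\mathrm{RE}_{3+\varpi}(s,\kappa)$ for some $\varpi,\kappa>0$. Suppose that for some $\phi>0$, with $\mu=\frac{\sqrt{T_{\min}}\,\phi}{14\alpha\sqrt{T_{\max}}\,s}$,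 one has for all groups $j\ne j'$ and all admissible positions $t_1\neq t_2$ $$(\Psi[j,j])_{t_1,t_1}=\phi,\quad |(\Psi[j,j])_{t_1,t_2}|\le\frac{\mu}{T_j},\quad |(\Psi[j,j'])_{t_1,t_1}|\le\mu,\quad |(\Psi[j,j'])_{t_1,t_2}|\le\frac{\mu}{\sqrt{T_jT_{j'}}}.$$ Let $c=\frac32+\frac{16}{7(\alpha-1)}$ and assume $\min_{i\in\mathcal C_j}|\beta^*_i|>\frac{2c}{\phi}\lambda\sqrt{T_{\max}}$ for every $j\in A(\beta^*)$. Then, with probability at least $1-2k\eta$, every minimiser $\hat\beta$ of $F_{t,\lambda}$ over $B[\beta^*;\epsilon]$ satisfies $$\max_{j\notin A(\beta^*)}\max_{i\in\mathcal C_j}|\hat\beta_i|\le\frac c\phi\lambda\sqrt{T_{\max}}<\min_{j\in A(\beta^*)}\min_{i\in\mathcal C_j}|\hat\beta_i|,$$ so that $\{i:|\hat\beta_i|>\frac c\phi\lambda\sqrt{T_{\max}}\}=\{i:\beta^*_i\ne0\}$, i.e. thresholding at this level recovers the support exactly. -/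

import Mathlib

open MeasureTheory ProbabilityTheory
open scoped Matrix ENNReal NNReal

noncomputable section

namespace HeatFlow

/-- The Euclidean norm of a real vector indexed by a finite type. -/
def l2 {ι : Type*} [Fintype ι] (v : ι → ℝ) : ℝ := ‖WithLp.toLp 2 v‖

section Penalty

variable {V : Type*} [Fintype V] [DecidableEq V] (G : SimpleGraph V) [DecidableRel G.Adj]

/-- The heat kernel `e^{-tL}` of the graph, `L = D - A` being its Laplacian matrix. -/
def heatKernel (t : ℝ) : Matrix V V ℝ := NormedSpace.exp (-(t • G.lapMatrix ℝ))

/-- The heat flow penalty `Λ_t(β) = ⟨Φ(e^{-tL}(β ⊙ β)), 1⟩`, where `Φ` takes the square root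
of the absolute value of each coordinate. -/
def penalty (t : ℝ) (β : V → ℝ) : ℝ :=
  ∑ v, √|(heatKernel G t *ᵥ (β * β)) v|

/-- The penalised least squares objective
`F_{t,λ}(β) = (1 / 2n) ‖y - Xβ‖₂² + λ Λ_t(β)`. -/
def objective {n : ℕ} (X : Matrix (Fin n) V ℝ) (y : Fin n → ℝ) (t lam : ℝ) (β : V → ℝ) : ℝ :=
  1 / (2 * (n : ℝ)) * l2 (y - X *ᵥ β) ^ 2 + lam * penalty G t β

end Penalty

section Design

variable {V : Type*} [Fintype V] {n : ℕ}

/-- `B[β*; ε] = {β : n^{-1/2} ‖X(β - β*)‖₂ ≤ ε}`. -/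
def predBall (X : Matrix (Fin n) V ℝ) (βs : V → ℝ) (ε : ℝ) : Set (V → ℝ) :=
  {β | (√(n : ℝ))⁻¹ * l2 (X *ᵥ (β - βs)) ≤ ε}

/-- The Gram matrix `(1/n) Xᵀ X`. Its blocks along the groups are the `Ψ[j, j']`. -/
def gram (X : Matrix (Fin n) V ℝ) : Matrix V V ℝ := (n : ℝ)⁻¹ • (Xᵀ * X)

end Design

section Groups

variable {V : Type*} [Fintype V] (G : SimpleGraph V)

/-- The vertices of a connected component of `G`; these sets are the groups of variables. -/
abbrev Group (j : G.ConnectedComponent) : Type _ := {v : V // G.connectedComponentMk v = j}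

/-- The size `T_j` of a group. -/
def groupSize (j : G.ConnectedComponent) : ℕ := Nat.card (Group G j)

/-- The largest group size. -/
def Tmax : ℕ := ⨆ j : G.ConnectedComponent, groupSize G j

/-- The smallest group size. -/
def Tmin : ℕ := ⨅ j : G.ConnectedComponent, groupSize G j

open scoped Classical in
/-- `‖β^j‖₂`, the Euclidean norm of the restriction of `β` to the group `j`. -/
def groupNorm (β : V → ℝ) (j : G.ConnectedComponent) : ℝ :=
  l2 (fun v : Group G j => β v)

/-- The set `A(β)` of active groups of `β`. -/
def activeSet (β : V → ℝ) : Set G.ConnectedComponent := {j | groupNorm G β j ≠ 0}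

open scoped Classical in
/-- The restricted eigenvalue property `RE_γ(s, κ)` of a matrix `M`, for the groups of `G`. -/
def RestrictedEigenvalue {m : Type*} [Fintype m] (γ : ℝ) (s : ℕ) (κ : ℝ)
    (M : Matrix m V ℝ) : Prop :=
  ∀ A : Set G.ConnectedComponent, A.ncard ≤ s → ∀ Δ : V → ℝ, Δ ≠ 0 →
    ∑ᶠ j ∈ Aᶜ, √(groupSize G j : ℝ) * groupNorm G Δ j ≤
      γ * ∑ᶠ j ∈ A, √(groupSize G j : ℝ) * groupNorm G Δ j →
    κ * √(∑ v with G.connectedComponentMk v ∈ A, Δ v ^ 2) ≤ l2 (M *ᵥ Δ)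

open scoped Classical in
/-- The operator norm (with respect to Euclidean norms) of the diagonal block
`Ψ[j, j] = (1/n) X_jᵀ X_j` of the Gram matrix. -/
def blockOpNorm {n : ℕ} (X : Matrix (Fin n) V ℝ) (j : G.ConnectedComponent) : ℝ :=
  ‖Matrix.toEuclideanCLM (𝕜 := ℝ)
    ((gram X).submatrix (fun v : Group G j => (v : V)) (fun v : Group G j => (v : V)))‖

/-- `Λ(X; η) = max_j ‖Ψ[j, j]‖_op^{1/2} (1 + (4 log η⁻¹ / T_j)^{1/2})`. -/
def noiseLevel {n : ℕ} (X : Matrix (Fin n) V ℝ) (η : ℝ) : ℝ :=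
  ⨆ j : G.ConnectedComponent,
    √(blockOpNorm G X j) * (1 + √(4 * Real.log η⁻¹ / (groupSize G j : ℝ)))

/-- An enumeration of the variables within every group, by `0, …, T_j - 1`. It says which entry
of a block `Ψ[j, j']` is called the `(t, t')` entry. -/
abbrev GroupLabelling : Type _ := ∀ j : G.ConnectedComponent, Group G j ≃ Fin (groupSize G j)

/-- The label of a variable within its group. -/
def label (e : GroupLabelling G) (v : V) : ℕ := (e (G.connectedComponentMk v) ⟨v, rfl⟩ : ℕ)

/-- The coherence level `√T_min φ / (14 α √T_max s)`. -/
def coherenceLevel (s : ℕ) (α φ : ℝ) : ℝ :=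
  √(Tmin G : ℝ) * φ / (14 * α * √(Tmax G : ℝ) * s)

/-- The coherence assumption on the blocks `Ψ[j, j']` of the Gram matrix: with
`μ = √T_min φ / (14 α √T_max s)`, all diagonal entries of the Gram matrix equal `φ`; the off-diagonal
entries of `Ψ[j, j]` are at most `μ / T_j`; and for `j ≠ j'` the entries `(t, t)` of `Ψ[j, j']`
are at most `μ`, while the entries `(t, t')`, `t ≠ t'`, are at most `μ / √(T_j T_j')`
(all in absolute value). -/
structure BlockCoherence {n : ℕ} (X : Matrix (Fin n) V ℝ) (e : GroupLabelling G)
    (s : ℕ) (α φ : ℝ) : Prop where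
  diag : ∀ v, gram X v v = φ
  within : ∀ v w, v ≠ w → G.connectedComponentMk v = G.connectedComponentMk w →
    |gram X v w| ≤ coherenceLevel G s α φ / (groupSize G (G.connectedComponentMk v) : ℝ)
  across_same : ∀ v w, G.connectedComponentMk v ≠ G.connectedComponentMk w →
    label G e v = label G e w → |gram X v w| ≤ coherenceLevel G s α φ
  across_ne : ∀ v w, G.connectedComponentMk v ≠ G.connectedComponentMk w →
    label G e v ≠ label G e w →
    |gram X v w| ≤ coherenceLevel G s α φ /
      √((groupSize G (G.connectedComponentMk v) : ℝ) * groupSize G (G.connectedComponentMk w))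

/-- The constant `c = 3/2 + 16 / (7 (α - 1))`. -/
def cConst (α : ℝ) : ℝ := 3 / 2 + 16 / (7 * (α - 1))

/-- The threshold `(c/φ) λ √T_max`. -/
def threshold (α φ lam : ℝ) : ℝ := cConst α / φ * lam * √(Tmax G : ℝ)

end Groups

end HeatFlow

end

/-! The penalty is compared with the group lasso penalty `∑ j, √T_j ‖β^j‖`, and coherence turns the
resulting error bound into a coordinatewise one.

The heat kernel is block diagonal and symmetric with row sums 1, and its entries within a group of
size `T_j` tend to `1 / T_j`. For large `t` they are therefore at least `r² / T_j` with `r < 1`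
prescribed. Then `Λ_t` is a seminorm lying between `r` times the group lasso penalty and that
penalty (`le_penalty`, `penalty_le`).

A Gaussian tail bound for each `X_jᵀ ε` and a union bound over the groups give the only random
input, `exists_noise_event`. All the rest is deterministic on that event.

Let `d` be the error of a minimiser. Comparing the objective with its value at `β*`
(`gramForm_self_add_le`) puts `d` in a cone, with inactive part at most `γ = 3 / (2r - 1)` times the
active part, and bounds the Gram form of `d`. Coherence makes the Gram form `φ` times the inner
product up to `2μ (∑ ‖x^j‖)(∑ ‖y^j‖)` (`abs_gramForm_sub_le`), so the same comparison bounds `∑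
‖d^j‖` (`coherence_mul_le`).

Moving one coordinate of the minimiser gives a first order condition (`abs_gramForm_single_le`).
With coherence applied to a unit vector and `d`, it yields `φ |d_v| ≤ (1/2 + 1 + 16 / (7(α - 1))) λ
√T_max`: noise, penalty and coherence error in this order (`abs_error_le`). Signals above twice this
error survive the threshold, and zero coordinates stay below it. -/

noncomputable section

namespace HeatFlow

/-! ### Groups and summation over groups. -/

section GroupSize

variable {V : Type*} [Fintype V] (G : SimpleGraph V)

theorem groupSize_pos (j : G.ConnectedComponent) : 0 < groupSize G j := by
  obtain ⟨v, hv⟩ := j.exists_rep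
  have : Nonempty (Group G j) := ⟨⟨v, hv⟩⟩
  exact Nat.card_pos

open scoped Classical in
/-- The set of variables in a group. -/
def groupVerts (j : G.ConnectedComponent) : Finset V := {v | G.connectedComponentMk v = j}

theorem mem_groupVerts {j : G.ConnectedComponent} {v : V} :
    v ∈ groupVerts G j ↔ G.connectedComponentMk v = j := by
  simp [groupVerts]

theorem groupSize_eq_card (j : G.ConnectedComponent) : groupSize G j = (groupVerts G j).card := by
  classical
  rw [groupSize, Nat.card_eq_fintype_card, Fintype.card_of_subtype _ fun v => mem_groupVerts G]

theorem sum_groupVerts {M : Type*} [AddCommMonoid M] [Fintype G.ConnectedComponent] (f : V → M) :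
    ∑ j, ∑ v ∈ groupVerts G j, f v = ∑ v, f v := by
  classical
  exact Finset.sum_fiberwise Finset.univ G.connectedComponentMk f

end GroupSize

/-! ### The heat kernel and its large time limit. -/

section HeatKernel

variable {V : Type*} [Fintype V] [DecidableEq V] (G : SimpleGraph V) [DecidableRel G.Adj]

theorem heatKernel_symm (t : ℝ) (v w : V) : heatKernel G t v w = heatKernel G t w v := by
  have h : (heatKernel G t).IsSymm := by
    refine Matrix.IsSymm.exp ?_
    exact ((G.isSymm_lapMatrix (R := ℝ)).smul t).neg
  exact h.apply w v

/-- Functions which are constant on the components are fixed by the heat flow. -/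
theorem heatKernel_mulVec_of_lapMatrix (t : ℝ) {z : V → ℝ} (hz : G.lapMatrix ℝ *ᵥ z = 0) :
    heatKernel G t *ᵥ z = z := by
  let : NormedRing (Matrix V V ℝ) := Matrix.linftyOpNormedRing
  let : NormedAlgebra ℝ (Matrix V V ℝ) := Matrix.linftyOpNormedAlgebra
  let : NormedAlgebra ℚ (Matrix V V ℝ) := .restrictScalars ℚ ℝ _
  -- Every column of this matrix `Z` is `z`, so `L Z = 0 = Z 0`, and exponentiating gives `e^{-tL} Z
  -- = Z`.
  have h : SemiconjBy (Matrix.of fun v (_ : V) => z v) 0 (-(t • G.lapMatrix ℝ)) := by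
    ext v w
    have := congrFun hz v
    simp only [Matrix.mulVec, dotProduct, Pi.zero_apply] at this
    simp [Matrix.mul_apply, mul_assoc, ← Finset.mul_sum, this]
  have h2 : SemiconjBy _ (NormedSpace.exp 0) (heatKernel G t) := h.exp_right
  rw [NormedSpace.exp_zero] at h2
  ext v
  have := congrFun (congrFun h2.eq v) v
  simpa [Matrix.mul_apply, Matrix.mulVec, dotProduct, Matrix.one_apply] using this.symm

open scoped Classical in
-- The indicator of a component lies in the kernel of the Laplacian, hence is fixed by the flow.
theorem sum_heatKernel_component (t : ℝ) (v : V) (j : G.ConnectedComponent) :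
    ∑ w ∈ groupVerts G j, heatKernel G t v w =
      if G.connectedComponentMk v = j then 1 else 0 := by
  have hz : G.lapMatrix ℝ *ᵥ (fun w => if G.connectedComponentMk w = j then (1 : ℝ) else 0) = 0 := by
    rw [SimpleGraph.lapMatrix_mulVec_eq_zero_iff_forall_reachable]
    intro a b hab
    rw [SimpleGraph.ConnectedComponent.sound hab]
  have := congrFun (heatKernel_mulVec_of_lapMatrix G t hz) v
  rw [← this, groupVerts, Finset.sum_filter]
  simp [Matrix.mulVec, dotProduct]

/-- The diagonal projection onto a component commutes with the Laplacian, hence with the heat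
kernel; the `(v, w)` entries of the two products then differ unless the kernel vanishes there. -/
theorem heatKernel_eq_zero (t : ℝ) {v w : V}
    (h : G.connectedComponentMk v ≠ G.connectedComponentMk w) : heatKernel G t v w = 0 := by
  classical
  let : NormedRing (Matrix V V ℝ) := Matrix.linftyOpNormedRing
  let : NormedAlgebra ℝ (Matrix V V ℝ) := Matrix.linftyOpNormedAlgebra
  let : NormedAlgebra ℚ (Matrix V V ℝ) := .restrictScalars ℚ ℝ _
  have hc : Commute (Matrix.diagonal fun a =>
      if G.connectedComponentMk a = G.connectedComponentMk v then (1 : ℝ) else 0)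
      (-(t • G.lapMatrix ℝ)) := by
    ext a b
    simp only [Matrix.diagonal_mul, Matrix.mul_diagonal, Matrix.neg_apply, Matrix.smul_apply]
    by_cases hab : G.connectedComponentMk a = G.connectedComponentMk b
    · rw [hab, mul_comm]
    · have hne : a ≠ b := fun e => hab (by rw [e])
      have hadj : ¬ G.Adj a b := fun e => hab (SimpleGraph.ConnectedComponent.sound e.reachable)
      simp [SimpleGraph.lapMatrix, SimpleGraph.degMatrix, hne, hadj]
  have := congrFun (congrFun hc.exp_right.eq v) w
  simp only [Matrix.diagonal_mul, Matrix.mul_diagonal, if_neg h.symm] at this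
  simpa [heatKernel] using this

open scoped Classical in
/-- The entries of the heat kernel converge; the limit is annihilated by the Laplacian. -/
theorem exists_tendsto_heatKernel : ∃ Q : Matrix V V ℝ, G.lapMatrix ℝ * Q = 0 ∧
    ∀ v w, Filter.Tendsto (fun t => heatKernel G t v w) Filter.atTop (nhds (Q v w)) := by
  have hA := G.isHermitian_lapMatrix (R := ℝ)
  have hpos := SimpleGraph.posSemidef_lapMatrix ℝ G
  set U : Matrix V V ℝ := (hA.eigenvectorUnitary : Matrix V V ℝ) with hU
  have hUU : star U * U = 1 := Unitary.coe_star_mul_self _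
  have hUU' : U * star U = 1 := Unitary.coe_mul_star_self _
  have hspec : G.lapMatrix ℝ = U * Matrix.diagonal hA.eigenvalues * star U := by
    have := hA.spectral_theorem
    rw [Unitary.conjStarAlgAut_apply] at this
    exact this
  have hd : ∀ i, 0 ≤ hA.eigenvalues i := hpos.eigenvalues_nonneg
  generalize hA.eigenvalues = d at hspec hd
  have hunit : IsUnit U := ⟨⟨U, star U, hUU', hUU⟩, rfl⟩
  have hinv : U⁻¹ = star U := Matrix.inv_eq_right_inv hUU'
  -- The limit is the orthogonal projection onto the kernel of the Laplacian: `e^{-t d_i}` tends to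
  -- 1 if `d_i = 0` and to 0 otherwise.
  refine ⟨U * Matrix.diagonal (fun i => if d i = 0 then 1 else 0) * star U, ?_, ?_⟩
  · rw [hspec]
    have : U * Matrix.diagonal d * star U *
        (U * Matrix.diagonal (fun i => if d i = 0 then (1 : ℝ) else 0) * star U) =
        U * (Matrix.diagonal d * (star U * U) *
          Matrix.diagonal (fun i => if d i = 0 then (1 : ℝ) else 0)) * star U := by
      simp only [Matrix.mul_assoc]
    rw [this, hUU, mul_one, Matrix.diagonal_mul_diagonal]
    have : (fun i => d i * if d i = 0 then (1 : ℝ) else 0) = 0 := by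
      ext i; simp
    rw [this]; simp
  · intro v w
    have hexp : ∀ t, heatKernel G t v w =
        (U * Matrix.diagonal (fun i => Real.exp (-(t * d i))) * star U) v w := by
      intro t
      have : -(t • G.lapMatrix ℝ) =
          U * Matrix.diagonal (fun i => -(t * d i)) * U⁻¹ := by
        rw [hinv]
        have : Matrix.diagonal (fun i => -(t * d i)) =
            -(t • Matrix.diagonal d) := by
          ext a b; by_cases h : a = b <;> simp [h]
        rw [this]
        conv_lhs => rw [hspec]
        simp
      rw [heatKernel, this, Matrix.exp_conj _ _ hunit, Matrix.exp_diagonal, hinv]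
      have : NormedSpace.exp (fun i => -(t * d i)) = fun i => Real.exp (-(t * d i)) := by
        ext i
        rw [Pi.coe_exp, Real.exp_eq_exp_ℝ]
      rw [this]
    simp only [hexp, Matrix.mul_apply (N := star U), Matrix.mul_diagonal]
    refine tendsto_finsetSum _ fun i _ => ?_
    refine Filter.Tendsto.mul_const _ (Filter.Tendsto.const_mul _ ?_)
    split_ifs with h
    · simp [h]
    · have hp : 0 < d i := lt_of_le_of_ne (hd i) (Ne.symm h)
      exact Real.tendsto_exp_neg_atTop_nhds_zero.comp
        (Filter.tendsto_id.atTop_mul_const hp)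

/-- The columns of the limit are annihilated by the Laplacian, so they are constant on components.
By symmetry the rows are too, and the row sum 1 over the component fixes the value. -/
theorem tendsto_heatKernel {v w : V} (h : G.connectedComponentMk v = G.connectedComponentMk w) :
    Filter.Tendsto (fun t => heatKernel G t v w) Filter.atTop
      (nhds (1 / (groupSize G (G.connectedComponentMk v) : ℝ))) := by
  classical
  obtain ⟨Q, hQ, hlim⟩ := exists_tendsto_heatKernel G
  have hsymm : ∀ a b, Q a b = Q b a := fun a b =>
    tendsto_nhds_unique (hlim a b) (by simpa only [heatKernel_symm G _ a b] using hlim b a)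
  have hconst : ∀ a b c, G.Reachable a b → Q a c = Q b c := by
    intro a b c hab
    refine (SimpleGraph.lapMatrix_mulVec_eq_zero_iff_forall_reachable G
      (x := fun a => Q a c)).1 ?_ a b hab
    ext a
    simpa [Matrix.mul_apply, Matrix.mulVec, dotProduct] using congrFun (congrFun hQ a) c
  have hsum : ∑ u ∈ groupVerts G (G.connectedComponentMk v), Q v u = 1 := by
    have h1 := tendsto_finsetSum
      (groupVerts G (G.connectedComponentMk v))
      (fun u _ => hlim v u)
    simp only [sum_heatKernel_component, if_true] at h1
    exact (tendsto_nhds_unique h1 tendsto_const_nhds)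
  have hall : ∀ u ∈ groupVerts G (G.connectedComponentMk v),
      Q v u = Q v w := by
    intro u hu
    rw [hsymm v u, hsymm v w]
    refine hconst _ _ _ (SimpleGraph.ConnectedComponent.exact ?_)
    rw [← h]; exact (mem_groupVerts G).1 hu
  rw [Finset.sum_congr rfl hall, Finset.sum_const, ← groupSize_eq_card, nsmul_eq_mul] at hsum
  have : (groupSize G (G.connectedComponentMk v) : ℝ) ≠ 0 := by
    exact_mod_cast (groupSize_pos G _).ne'
  have hq : Q v w = 1 / (groupSize G (G.connectedComponentMk v) : ℝ) := by
    field_simp; linarith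
  rw [← hq]; exact hlim v w

/-- For large times the heat kernel is close to the averaging over the components. -/
theorem exists_le_heatKernel {r : ℝ} (hr : r < 1) : ∃ t₀ : ℝ, ∀ t, t₀ ≤ t → ∀ v w,
    G.connectedComponentMk v = G.connectedComponentMk w →
      r / (groupSize G (G.connectedComponentMk v) : ℝ) ≤ heatKernel G t v w := by
  have : ∀ᶠ t in Filter.atTop, ∀ v w, G.connectedComponentMk v = G.connectedComponentMk w →
      r / (groupSize G (G.connectedComponentMk v) : ℝ) ≤ heatKernel G t v w := by
    refine Filter.eventually_all.2 fun v => Filter.eventually_all.2 fun w => ?_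
    by_cases h : G.connectedComponentMk v = G.connectedComponentMk w
    · have hp : (0 : ℝ) < groupSize G (G.connectedComponentMk v) := by
        exact_mod_cast groupSize_pos G _
      filter_upwards [(tendsto_heatKernel G h).eventually_const_le
        ((div_lt_div_iff_of_pos_right hp).2 hr)] with t ht _ using ht
    · exact Filter.Eventually.of_forall fun t e => absurd e h
  exact Filter.eventually_atTop.1 this

end HeatKernel

/-! ### Restriction to a set of groups, and group norms. -/

section Restrict

variable {V : Type*} (G : SimpleGraph V)

/-- The restriction of a vector to a set of groups, extended by zero. -/
def restrict (A : Set G.ConnectedComponent) (x : V → ℝ) : V → ℝ :=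
  Set.indicator {v | G.connectedComponentMk v ∈ A} x

theorem restrict_of_mem {A : Set G.ConnectedComponent} (x : V → ℝ) {v : V}
    (h : G.connectedComponentMk v ∈ A) : restrict G A x v = x v :=
  Set.indicator_of_mem (s := {v | G.connectedComponentMk v ∈ A}) h x

theorem restrict_of_notMem {A : Set G.ConnectedComponent} (x : V → ℝ) {v : V}
    (h : G.connectedComponentMk v ∉ A) : restrict G A x v = 0 :=
  Set.indicator_of_notMem (s := {v | G.connectedComponentMk v ∈ A}) h x

theorem restrict_add_restrict_compl (A : Set G.ConnectedComponent) (x : V → ℝ) :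
    restrict G A x + restrict G Aᶜ x = x :=
  Set.indicator_self_add_compl {v | G.connectedComponentMk v ∈ A} x

end Restrict

section Norms

theorem l2_nonneg {ι : Type*} [Fintype ι] (v : ι → ℝ) : 0 ≤ l2 v := norm_nonneg _

theorem l2_sq {ι : Type*} [Fintype ι] (v : ι → ℝ) : l2 v ^ 2 = ∑ i, v i ^ 2 := by
  simp [l2, EuclideanSpace.norm_sq_eq]

theorem l2_add_le {ι : Type*} [Fintype ι] (v w : ι → ℝ) : l2 (v + w) ≤ l2 v + l2 w := by
  simpa [l2] using norm_add_le (WithLp.toLp 2 v) (WithLp.toLp 2 w)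

theorem l2_smul {ι : Type*} [Fintype ι] (c : ℝ) (v : ι → ℝ) : l2 (c • v) = |c| * l2 v := by
  simp [l2, norm_smul]

variable {V : Type*} [Fintype V] (G : SimpleGraph V)

open scoped Classical in
theorem groupNorm_nonneg (x : V → ℝ) (j : G.ConnectedComponent) : 0 ≤ groupNorm G x j :=
  l2_nonneg _

open scoped Classical in
theorem groupNorm_sq (x : V → ℝ) (j : G.ConnectedComponent) :
    groupNorm G x j ^ 2 = ∑ v ∈ groupVerts G j, x v ^ 2 := by
  unfold groupNorm
  rw [l2_sq]
  exact (Finset.sum_subtype _ (fun v => mem_groupVerts G) fun v => x v ^ 2).symm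

theorem groupNorm_eq_sqrt (x : V → ℝ)
    (j : G.ConnectedComponent) :
    groupNorm G x j = √(∑ v ∈ groupVerts G j, x v ^ 2) := by
  rw [← groupNorm_sq, Real.sqrt_sq (groupNorm_nonneg G x j)]

theorem groupNorm_restrict_of_mem {A : Set G.ConnectedComponent} (x : V → ℝ)
    {j : G.ConnectedComponent} (h : j ∈ A) : groupNorm G (restrict G A x) j = groupNorm G x j := by
  classical
  rw [groupNorm_eq_sqrt, groupNorm_eq_sqrt]
  congr 1
  refine Finset.sum_congr rfl fun v hv => ?_
  rw [restrict_of_mem]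
  rwa [(mem_groupVerts G).1 hv]

theorem groupNorm_restrict_of_notMem {A : Set G.ConnectedComponent} (x : V → ℝ)
    {j : G.ConnectedComponent} (h : j ∉ A) : groupNorm G (restrict G A x) j = 0 := by
  classical
  rw [groupNorm_eq_sqrt, Finset.sum_eq_zero, Real.sqrt_zero]
  intro v hv
  rw [restrict_of_notMem]
  · simp
  · rwa [(mem_groupVerts G).1 hv]

theorem eq_zero_of_notMem_activeSet {x : V → ℝ} {v : V}
    (h : G.connectedComponentMk v ∉ activeSet G x) : x v = 0 := by
  classical
  have h0 : groupNorm G x (G.connectedComponentMk v) = 0 := not_not.1 h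
  have h1 := groupNorm_sq G x (G.connectedComponentMk v)
  rw [h0, zero_pow two_ne_zero] at h1
  have := (Finset.sum_eq_zero_iff_of_nonneg fun i _ => sq_nonneg (x i)).1 h1.symm v
    ((mem_groupVerts G).2 rfl)
  exact pow_eq_zero_iff two_ne_zero |>.1 this

theorem sum_abs_le_sqrt_groupSize_mul (x : V → ℝ)
    (j : G.ConnectedComponent) :
    ∑ v ∈ groupVerts G j, |x v| ≤ √(groupSize G j : ℝ) * groupNorm G x j := by
  rw [groupNorm_eq_sqrt, groupSize_eq_card]
  have := Real.sum_mul_le_sqrt_mul_sqrt (groupVerts G j)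
    (fun _ => (1 : ℝ)) (fun v => |x v|)
  simpa using this

theorem sum_mul_le_groupNorm [Fintype G.ConnectedComponent] (x y : V → ℝ) :
    ∑ v, x v * y v ≤ ∑ j, groupNorm G x j * groupNorm G y j := by
  classical
  rw [← sum_groupVerts G]
  refine Finset.sum_le_sum fun j _ => ?_
  rw [groupNorm_eq_sqrt, groupNorm_eq_sqrt]
  exact Real.sum_mul_le_sqrt_mul_sqrt _ _ _

end Norms

/-! ### Comparison of the heat flow penalty with the group lasso penalty. -/

section Penalty

variable {V : Type*} [Fintype V] [DecidableEq V] (G : SimpleGraph V) [DecidableRel G.Adj] {t : ℝ}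

/-- With a nonnegative kernel the penalty is a sum of weighted Euclidean norms; subadditivity and
homogeneity follow at once. -/
theorem penalty_eq_sum_l2 (hK : ∀ v w, 0 ≤ heatKernel G t v w) (x : V → ℝ) :
    penalty G t x = ∑ v, l2 (fun w => √(heatKernel G t v w) * x w) := by
  refine Finset.sum_congr rfl fun v _ => ?_
  have : (heatKernel G t *ᵥ (x * x)) v = l2 (fun w => √(heatKernel G t v w) * x w) ^ 2 := by
    rw [l2_sq]
    simp only [Matrix.mulVec, dotProduct, Pi.mul_apply]
    refine Finset.sum_congr rfl fun w _ => ?_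
    rw [mul_pow, Real.sq_sqrt (hK v w), sq (x w)]
  rw [this, abs_of_nonneg (sq_nonneg _), Real.sqrt_sq (l2_nonneg _)]

theorem penalty_add_le (hK : ∀ v w, 0 ≤ heatKernel G t v w) (x y : V → ℝ) :
    penalty G t (x + y) ≤ penalty G t x + penalty G t y := by
  simp only [penalty_eq_sum_l2 G hK, ← Finset.sum_add_distrib]
  refine Finset.sum_le_sum fun v _ => ?_
  refine le_of_eq_of_le (congrArg l2 ?_) (l2_add_le _ _)
  ext w
  simp [mul_add]

theorem penalty_smul (hK : ∀ v w, 0 ≤ heatKernel G t v w) (c : ℝ) (x : V → ℝ) :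
    penalty G t (c • x) = |c| * penalty G t x := by
  simp only [penalty_eq_sum_l2 G hK, Finset.mul_sum]
  refine Finset.sum_congr rfl fun v _ => ?_
  rw [← l2_smul]
  congr 1
  ext w
  simp [mul_left_comm]

theorem heatKernel_mulVec_restrict (A : Set G.ConnectedComponent) (x : V → ℝ) (v : V) :
    (heatKernel G t *ᵥ (restrict G A x * restrict G A x)) v =
      restrict G A (heatKernel G t *ᵥ (x * x)) v := by
  by_cases hv : G.connectedComponentMk v ∈ A
  · rw [restrict_of_mem G _ hv]
    refine Finset.sum_congr rfl fun w _ => ?_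
    beta_reduce
    by_cases hw : G.connectedComponentMk w ∈ A
    · simp [restrict_of_mem G _ hw]
    · rw [heatKernel_eq_zero G t (fun e => hw (e ▸ hv)), zero_mul, zero_mul]
  · rw [restrict_of_notMem G _ hv]
    refine Finset.sum_eq_zero fun w _ => ?_
    beta_reduce
    by_cases hw : G.connectedComponentMk w ∈ A
    · rw [heatKernel_eq_zero G t (fun e => hv (e.symm ▸ hw)), zero_mul]
    · simp [restrict_of_notMem G _ hw]

/-- The penalty is additive over a splitting of the groups. -/
theorem penalty_eq_add_restrict (A : Set G.ConnectedComponent) (x : V → ℝ) :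
    penalty G t x = penalty G t (restrict G A x) + penalty G t (restrict G Aᶜ x) := by
  rw [penalty, penalty, penalty, ← Finset.sum_add_distrib]
  refine Finset.sum_congr rfl fun v _ => ?_
  rw [heatKernel_mulVec_restrict, heatKernel_mulVec_restrict]
  by_cases hv : G.connectedComponentMk v ∈ A
  · rw [restrict_of_mem G _ hv, restrict_of_notMem G _ (not_not.2 hv)]
    simp
  · rw [restrict_of_notMem G _ hv, restrict_of_mem G _ (show _ ∈ Aᶜ from hv)]
    simp

theorem sum_mulVec_heatKernel (z : V → ℝ)
    (j : G.ConnectedComponent) :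
    ∑ v ∈ groupVerts G j, (heatKernel G t *ᵥ z) v =
      ∑ w ∈ groupVerts G j, z w := by
  simp only [Matrix.mulVec, dotProduct]
  classical
  rw [Finset.sum_comm, groupVerts, Finset.sum_filter, ← groupVerts]
  refine Finset.sum_congr rfl fun w _ => ?_
  simp_rw [← Finset.sum_mul, heatKernel_symm G t _ w]
  rw [sum_heatKernel_component, ite_mul, one_mul, zero_mul]

/-- Cauchy–Schwarz in each group; the flow preserves the mass of `x ⊙ x` on a group, which is
`‖x^j‖²`. -/
theorem penalty_le [Fintype G.ConnectedComponent] (hK : ∀ v w, 0 ≤ heatKernel G t v w)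
    (x : V → ℝ) : penalty G t x ≤ ∑ j, √(groupSize G j : ℝ) * groupNorm G x j := by
  classical
  rw [penalty, ← sum_groupVerts G]
  refine Finset.sum_le_sum fun j _ => ?_
  have h := Real.sum_mul_le_sqrt_mul_sqrt (groupVerts G j)
    (fun _ => (1 : ℝ)) (fun v => √|(heatKernel G t *ᵥ (x * x)) v|)
  have h0 : ∀ v, 0 ≤ (heatKernel G t *ᵥ (x * x)) v := fun v =>
    Finset.sum_nonneg fun w _ => mul_nonneg (hK v w) (mul_self_nonneg _)
  simp only [one_mul, one_pow, Finset.sum_const, nsmul_eq_mul, mul_one, ← groupSize_eq_card,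
    abs_of_nonneg (h0 _), Real.sq_sqrt (h0 _), sum_mulVec_heatKernel] at h
  simp only [abs_of_nonneg (h0 _)]
  refine h.trans_eq ?_
  rw [groupNorm_eq_sqrt]
  simp [sq]

/-- The lower bound on the kernel spreads the mass of a group almost evenly: each of its `T_j`
coordinates contributes at least `r ‖x^j‖ / √T_j`. -/
theorem le_penalty [Fintype G.ConnectedComponent] {r : ℝ}
    (hK : ∀ v w, G.connectedComponentMk v = G.connectedComponentMk w →
      r ^ 2 / (groupSize G (G.connectedComponentMk v) : ℝ) ≤ heatKernel G t v w)
    (x : V → ℝ) : r * ∑ j, √(groupSize G j : ℝ) * groupNorm G x j ≤ penalty G t x := by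
  classical
  rw [penalty, ← sum_groupVerts G, Finset.mul_sum]
  refine Finset.sum_le_sum fun j _ => ?_
  have hT : (0 : ℝ) < groupSize G j := by exact_mod_cast groupSize_pos G j
  have key : ∀ v ∈ (groupVerts G j),
      r * groupNorm G x j / √(groupSize G j : ℝ) ≤ √|(heatKernel G t *ᵥ (x * x)) v| := by
    intro v hv
    rw [mem_groupVerts] at hv
    refine Real.le_sqrt_of_sq_le (le_trans ?_ (le_abs_self _))
    rw [div_pow, mul_pow, Real.sq_sqrt hT.le, groupNorm_sq, mul_div_right_comm, Finset.mul_sum,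
      Matrix.mulVec, dotProduct, groupVerts, Finset.sum_filter]
    refine Finset.sum_le_sum fun w _ => ?_
    split_ifs with hw
    · rw [sq (x w)]
      refine mul_le_mul_of_nonneg_right ?_ (mul_self_nonneg _)
      rw [← hv]
      exact hK v w (hv.trans hw.symm)
    · rw [heatKernel_eq_zero G t (fun e => hw (e.symm.trans hv)), zero_mul]
  refine le_trans (le_of_eq ?_) (Finset.card_nsmul_le_sum _ _ _ key)
  rw [← groupSize_eq_card, nsmul_eq_mul]
  have hs : √(groupSize G j : ℝ) ≠ 0 := (Real.sqrt_pos.2 hT).ne'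
  field_simp
  rw [Real.sq_sqrt hT.le]
  ring

theorem penalty_single_le (hK : ∀ v w, 0 ≤ heatKernel G t v w) (v : V) (c : ℝ) :
    penalty G t (Pi.single v c) ≤ √(groupSize G (G.connectedComponentMk v) : ℝ) * |c| := by
  classical
  have := Fintype.ofFinite G.ConnectedComponent
  refine (penalty_le G hK _).trans_eq ?_
  rw [Finset.sum_eq_single (G.connectedComponentMk v)]
  · rw [groupNorm_eq_sqrt, Finset.sum_eq_single v]
    · simp [Real.sqrt_sq_eq_abs]
    · intro w _ hw; simp [hw]
    · simp [mem_groupVerts]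
  · intro j _ hj
    rw [groupNorm_eq_sqrt, Finset.sum_eq_zero, Real.sqrt_zero, mul_zero]
    intro w hw
    have : w ≠ v := by rintro rfl; exact hj ((mem_groupVerts G).1 hw).symm
    simp [this]
  · simp

/-- The change of the penalty is controlled by the perturbation, up to the inactive groups. -/
theorem penalty_sub_penalty_add_le (hK : ∀ v w, 0 ≤ heatKernel G t v w) (x d : V → ℝ) :
    penalty G t x - penalty G t (x + d) ≤
      penalty G t (restrict G (activeSet G x) d) - penalty G t (restrict G (activeSet G x)ᶜ d) := by
  set A := activeSet G x
  have hx : restrict G A x = x := by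
    ext v
    by_cases hv : G.connectedComponentMk v ∈ A
    · exact restrict_of_mem G _ hv
    · rw [restrict_of_notMem G _ hv, eq_zero_of_notMem_activeSet G hv]
  -- The reverse triangle inequality is needed only on the active groups; off them `x` vanishes and
  -- `x + d` equals `d`.
  have h1 : restrict G A (x + d) + (-1 : ℝ) • restrict G A d = x := by
    conv_rhs => rw [← hx]
    ext v
    simp [restrict, Set.indicator_add']
  have h2 : restrict G Aᶜ (x + d) = restrict G Aᶜ d := by
    ext v
    by_cases hv : G.connectedComponentMk v ∈ A
    · rw [restrict_of_notMem G _ (not_not.2 hv), restrict_of_notMem G _ (not_not.2 hv)]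
    · rw [restrict_of_mem G _ (show _ ∈ Aᶜ from hv), restrict_of_mem G _ (show _ ∈ Aᶜ from hv),
        Pi.add_apply, eq_zero_of_notMem_activeSet G hv, zero_add]
  have h3 := penalty_add_le G hK (restrict G A (x + d)) ((-1 : ℝ) • restrict G A d)
  rw [h1, penalty_smul G hK] at h3
  rw [penalty_eq_add_restrict G A (x + d), h2]
  norm_num at h3
  linarith

end Penalty

/-! ### The Gram form under the coherence assumption. -/

section Coherence

variable {V : Type*} {n : ℕ}

theorem gram_symm (X : Matrix (Fin n) V ℝ) (v w : V) : gram X v w = gram X w v := by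
  simp [gram, Matrix.mul_apply, mul_comm]

theorem label_injective (G : SimpleGraph V) {e : GroupLabelling G} {v w : V}
    (h : G.connectedComponentMk v = G.connectedComponentMk w)
    (hl : label G e v = label G e w) : v = w := by
  -- The component becomes a variable, so that both labels are values of one and the same `e j`.
  have key : ∀ (j : G.ConnectedComponent) (hv : G.connectedComponentMk v = j),
      label G e v = (e j ⟨v, hv⟩ : ℕ) := by
    rintro j rfl; rfl
  rw [key _ h, label] at hl
  simpa using (e _).injective (Fin.ext hl)


section GramForm

variable [Fintype V]

/-- The bilinear form of the Gram matrix. -/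
def gramForm (X : Matrix (Fin n) V ℝ) (x y : V → ℝ) : ℝ := ∑ v, ∑ w, gram X v w * (x v * y w)

theorem gramForm_symm (X : Matrix (Fin n) V ℝ) (x y : V → ℝ) : gramForm X x y = gramForm X y x := by
  rw [gramForm, Finset.sum_comm]
  refine Finset.sum_congr rfl fun v _ => Finset.sum_congr rfl fun w _ => ?_
  rw [gram_symm, mul_comm (x w)]

theorem gramForm_add_left (X : Matrix (Fin n) V ℝ) (x x' y : V → ℝ) :
    gramForm X (x + x') y = gramForm X x y + gramForm X x' y := by
  simp only [gramForm, ← Finset.sum_add_distrib, Pi.add_apply]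
  refine Finset.sum_congr rfl fun v _ => Finset.sum_congr rfl fun w _ => ?_
  ring

theorem gramForm_smul_left (X : Matrix (Fin n) V ℝ) (c : ℝ) (x y : V → ℝ) :
    gramForm X (c • x) y = c * gramForm X x y := by
  simp only [gramForm, Finset.mul_sum, Pi.smul_apply, smul_eq_mul]
  refine Finset.sum_congr rfl fun v _ => Finset.sum_congr rfl fun w _ => ?_
  ring

theorem gramForm_eq_dotProduct (X : Matrix (Fin n) V ℝ) (x y : V → ℝ) :
    gramForm X x y = (n : ℝ)⁻¹ * (X *ᵥ x ⬝ᵥ X *ᵥ y) := by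
  have h : gramForm X x y = x ⬝ᵥ (gram X *ᵥ y) := by
    simp only [gramForm, dotProduct, Matrix.mulVec, Finset.mul_sum]
    refine Finset.sum_congr rfl fun v _ => Finset.sum_congr rfl fun w _ => ?_
    ring
  rw [h, gram, Matrix.smul_mulVec, dotProduct_smul, ← Matrix.mulVec_mulVec,
    Matrix.dotProduct_mulVec, Matrix.vecMul_transpose, smul_eq_mul]

theorem gramForm_self (X : Matrix (Fin n) V ℝ) (x : V → ℝ) :
    gramForm X x x = (n : ℝ)⁻¹ * l2 (X *ᵥ x) ^ 2 := by
  rw [gramForm_eq_dotProduct, l2_sq, dotProduct]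
  simp only [sq]

theorem gramForm_self_nonneg (X : Matrix (Fin n) V ℝ) (x : V → ℝ) : 0 ≤ gramForm X x x := by
  rw [gramForm_self]; positivity

end GramForm

variable (G : SimpleGraph V) {X : Matrix (Fin n) V ℝ} {e : GroupLabelling G} {s : ℕ} {α φ : ℝ}

open scoped Classical in
-- The coherence conditions merge into one bound: `μ` times the sum of a label matching matrix and
-- the rank one matrix `1 / √(T_j T_j')`. Within a group distinct variables have distinct labels, so
-- off the diagonal only the rank one term is present there.
theorem abs_gram_sub_le (hX : BlockCoherence G X e s α φ) (hμ : 0 ≤ coherenceLevel G s α φ)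
    (v w : V) : |gram X v w - if v = w then φ else 0| ≤
      coherenceLevel G s α φ * ((if label G e v = label G e w then 1 else 0) +
        (√(groupSize G (G.connectedComponentMk v) : ℝ))⁻¹ *
        (√(groupSize G (G.connectedComponentMk w) : ℝ))⁻¹) := by
  have hpos : 0 ≤ coherenceLevel G s α φ * ((√(groupSize G (G.connectedComponentMk v) : ℝ))⁻¹ *
        (√(groupSize G (G.connectedComponentMk w) : ℝ))⁻¹) := by positivity
  by_cases hvw : v = w
  · subst hvw
    rw [if_pos rfl, if_pos rfl, hX.diag, sub_self, abs_zero]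
    positivity
  rw [if_neg hvw, sub_zero, mul_add]
  by_cases hc : G.connectedComponentMk v = G.connectedComponentMk w
  · rw [if_neg fun hl => hvw (label_injective G hc hl), mul_zero, zero_add]
    refine (hX.within v w hvw hc).trans_eq ?_
    rw [← hc, ← mul_inv, Real.mul_self_sqrt (Nat.cast_nonneg _), div_eq_mul_inv]
  · split_ifs with hl
    · linarith [hX.across_same v w hc hl]
    · refine (hX.across_ne v w hc hl).trans_eq ?_
      rw [Real.sqrt_mul (Nat.cast_nonneg _), mul_zero, zero_add, div_eq_mul_inv, mul_inv]

variable [Fintype V]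

open scoped Classical in
-- Label matching between two groups is a partial permutation, hence has operator norm at most 1.
-- Cauchy–Schwarz over the matched pairs shows this, since each variable has at most one partner.
theorem sum_label_eq_le (x y : V → ℝ) (i j : G.ConnectedComponent) :
    ∑ v ∈ groupVerts G i, ∑ w ∈ groupVerts G j,
      (if label G e v = label G e w then 1 else 0) * (|x v| * |y w|) ≤
      groupNorm G x i * groupNorm G y j := by
  rw [← Finset.sum_product']
  have h := Real.sum_mul_le_sqrt_mul_sqrt (groupVerts G i ×ˢ groupVerts G j)
    (fun p => (if label G e p.1 = label G e p.2 then 1 else 0) * |x p.1|)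
    (fun p => (if label G e p.1 = label G e p.2 then 1 else 0) * |y p.2|)
  have hone : ∀ (k : G.ConnectedComponent) (l : ℕ),
      ∑ v ∈ groupVerts G k, (if l = label G e v then (1 : ℝ) else 0) ≤ 1 := by
    intro k l
    rw [← Finset.sum_filter, Finset.sum_const, nsmul_eq_mul, mul_one]
    exact_mod_cast Finset.card_le_one.2 fun a ha b hb => by
      rw [Finset.mem_filter, mem_groupVerts] at ha hb
      exact label_injective G (ha.1.trans hb.1.symm) (ha.2.symm.trans hb.2)
  refine le_trans (Finset.sum_le_sum fun p _ => ?_) (h.trans ?_)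
  · split_ifs <;> simp
  · refine mul_le_mul ?_ ?_ (Real.sqrt_nonneg _) (groupNorm_nonneg G x i)
    · rw [groupNorm_eq_sqrt]
      refine Real.sqrt_le_sqrt ?_
      rw [Finset.sum_product]
      refine Finset.sum_le_sum fun v _ => ?_
      simp only [mul_pow, sq_abs, ite_pow, one_pow, ne_eq, OfNat.ofNat_ne_zero, not_false_eq_true,
        zero_pow]
      rw [← Finset.sum_mul]
      exact mul_le_of_le_one_left (sq_nonneg _) (hone j _)
    · rw [groupNorm_eq_sqrt]
      refine Real.sqrt_le_sqrt ?_
      rw [Finset.sum_product_right]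
      refine Finset.sum_le_sum fun w _ => ?_
      simp only [mul_pow, sq_abs, ite_pow, one_pow, ne_eq, OfNat.ofNat_ne_zero, not_false_eq_true,
        zero_pow, eq_comm (b := label G e w)]
      rw [← Finset.sum_mul]
      exact mul_le_of_le_one_left (sq_nonneg _) (hone i _)

open scoped Classical in
/-- Under the coherence assumption the Gram form is close to a multiple of the inner product. -/
theorem abs_gramForm_sub_le [Fintype G.ConnectedComponent] (hX : BlockCoherence G X e s α φ)
    (hμ : 0 ≤ coherenceLevel G s α φ) (x y : V → ℝ) :
    |gramForm X x y - φ * ∑ v, x v * y v| ≤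
      2 * coherenceLevel G s α φ * (∑ j, groupNorm G x j) * ∑ j, groupNorm G y j := by
  set μ := coherenceLevel G s α φ
  have h1 : gramForm X x y - φ * ∑ v, x v * y v =
      ∑ v, ∑ w, (gram X v w - if v = w then φ else 0) * (x v * y w) := by
    simp only [gramForm, sub_mul, Finset.sum_sub_distrib, ite_mul, zero_mul, Finset.sum_ite_eq,
      Finset.mem_univ, if_true, Finset.mul_sum]
  have h2 : |gramForm X x y - φ * ∑ v, x v * y v| ≤
      ∑ v, ∑ w, μ * ((if label G e v = label G e w then 1 else 0) +
        (√(groupSize G (G.connectedComponentMk v) : ℝ))⁻¹ *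
        (√(groupSize G (G.connectedComponentMk w) : ℝ))⁻¹) * (|x v| * |y w|) := by
    rw [h1]
    refine (Finset.abs_sum_le_sum_abs _ _).trans (Finset.sum_le_sum fun v _ => ?_)
    refine (Finset.abs_sum_le_sum_abs _ _).trans (Finset.sum_le_sum fun w _ => ?_)
    rw [abs_mul, abs_mul (x v)]
    exact mul_le_mul_of_nonneg_right (abs_gram_sub_le G hX hμ v w) (by positivity)
  refine h2.trans ?_
  rw [← sum_groupVerts G, mul_assoc, Finset.sum_mul, Finset.mul_sum]
  refine Finset.sum_le_sum fun i _ => ?_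
  have h3 : ∀ v, ∑ w, μ * ((if label G e v = label G e w then 1 else 0) +
        (√(groupSize G (G.connectedComponentMk v) : ℝ))⁻¹ *
        (√(groupSize G (G.connectedComponentMk w) : ℝ))⁻¹) * (|x v| * |y w|) =
      ∑ j, ∑ w ∈ groupVerts G j, μ * ((if label G e v = label G e w then 1 else 0) +
        (√(groupSize G (G.connectedComponentMk v) : ℝ))⁻¹ *
        (√(groupSize G (G.connectedComponentMk w) : ℝ))⁻¹) * (|x v| * |y w|) :=
    fun v => (sum_groupVerts G _).symm
  simp only [h3]
  rw [Finset.sum_comm, Finset.mul_sum, Finset.mul_sum]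
  refine Finset.sum_le_sum fun j _ => ?_
  -- For a fixed pair of groups the rank one term factors into two normalised `ℓ¹` norms, each at
  -- most a group norm. Together with the label matching term this produces the factor 2.
  have hTi : 0 < √(groupSize G i : ℝ) := Real.sqrt_pos.2 (by exact_mod_cast groupSize_pos G i)
  have hTj : 0 < √(groupSize G j : ℝ) := Real.sqrt_pos.2 (by exact_mod_cast groupSize_pos G j)
  have h4 : ∑ v ∈ groupVerts G i, ∑ w ∈ groupVerts G j,
      (√(groupSize G (G.connectedComponentMk v) : ℝ))⁻¹ *
        (√(groupSize G (G.connectedComponentMk w) : ℝ))⁻¹ * (|x v| * |y w|) =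
      ((√(groupSize G i : ℝ))⁻¹ * ∑ v ∈ groupVerts G i, |x v|) *
        ((√(groupSize G j : ℝ))⁻¹ * ∑ w ∈ groupVerts G j, |y w|) := by
    rw [Finset.mul_sum, Finset.mul_sum, Finset.sum_mul_sum]
    refine Finset.sum_congr rfl fun v hv => Finset.sum_congr rfl fun w hw => ?_
    rw [(mem_groupVerts G).1 hv, (mem_groupVerts G).1 hw]
    ring
  have h5 : ∀ (k : G.ConnectedComponent) (z : V → ℝ), 0 < √(groupSize G k : ℝ) →
      (√(groupSize G k : ℝ))⁻¹ * ∑ v ∈ groupVerts G k, |z v| ≤ groupNorm G z k := by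
    intro k z hk
    rw [inv_mul_le_iff₀ hk]
    exact sum_abs_le_sqrt_groupSize_mul G z k
  have h6 := mul_le_mul (h5 i x hTi) (h5 j y hTj) (by positivity) (groupNorm_nonneg G x i)
  rw [← h4] at h6
  have h7 := sum_label_eq_le G (e := e) x y i j
  have h8 := mul_le_mul_of_nonneg_left (add_le_add h7 h6) hμ
  refine le_trans (le_of_eq ?_) (h8.trans_eq (by ring))
  simp only [← Finset.sum_add_distrib, Finset.mul_sum]
  refine Finset.sum_congr rfl fun v _ => Finset.sum_congr rfl fun w _ => ?_
  ring

end Coherence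

/-! ### Exponential moments and tails of Gaussian vectors. -/

section GaussianTail

theorem lintegral_exp_mul_gaussianReal (v : ℝ≥0) (c : ℝ) :
    ∫⁻ x, ENNReal.ofReal (Real.exp (c * x)) ∂gaussianReal 0 v =
      ENNReal.ofReal (Real.exp (v * c ^ 2 / 2)) := by
  rw [← ofReal_integral_eq_lintegral_ofReal (integrable_exp_mul_gaussianReal c)
    (Filter.Eventually.of_forall fun _ => (Real.exp_pos _).le)]
  have := congrFun (mgf_fun_id_gaussianReal (μ := 0) (v := v)) c
  rw [mgf] at this
  rw [this, zero_mul, zero_add]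

theorem lintegral_exp_sq_gaussianReal {a : ℝ} (ha : a < 1) :
    ∫⁻ x, ENNReal.ofReal (Real.exp (a * x ^ 2 / 2)) ∂gaussianReal 0 1 =
      ENNReal.ofReal (√(1 - a))⁻¹ := by
  have hb : 0 < (1 - a) / 2 := by linarith
  rw [gaussianReal_of_var_ne_zero _ one_ne_zero,
    lintegral_withDensity_eq_lintegral_mul _ (measurable_gaussianPDF _ _) (by fun_prop)]
  have h1 : ∀ x, (gaussianPDF 0 1 * fun x => ENNReal.ofReal (Real.exp (a * x ^ 2 / 2))) x =
      ENNReal.ofReal ((√(2 * Real.pi))⁻¹ * Real.exp (-((1 - a) / 2) * x ^ 2)) := by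
    intro x
    rw [Pi.mul_apply, gaussianPDF, gaussianPDFReal_def, ← ENNReal.ofReal_mul (by positivity)]
    congr 1
    simp only [NNReal.coe_one, mul_one, sub_zero, mul_assoc, ← Real.exp_add]
    congr 2
    ring
  simp only [h1]
  rw [← ofReal_integral_eq_lintegral_ofReal ((integrable_exp_neg_mul_sq hb).const_mul _)
    (Filter.Eventually.of_forall fun _ => by positivity), integral_const_mul, integral_gaussian]
  congr 1
  rw [← Real.sqrt_inv, ← Real.sqrt_inv, ← Real.sqrt_mul (by positivity)]
  congr 1
  have : 1 - a ≠ 0 := by linarith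
  field_simp

variable {ι κ : Type*} [Fintype ι] [Fintype κ]

theorem lintegral_prod_pi (μ : ι → Measure ℝ) [∀ i, IsProbabilityMeasure (μ i)]
    {f : ι → ℝ → ℝ} (hf : ∀ i x, 0 ≤ f i x) (hint : ∀ i, Integrable (f i) (μ i)) :
    ∫⁻ x, ENNReal.ofReal (∏ i, f i (x i)) ∂Measure.pi μ =
      ∏ i, ∫⁻ x, ENNReal.ofReal (f i x) ∂μ i := by
  rw [← ofReal_integral_eq_lintegral_ofReal (Integrable.fintype_prod hint)
    (Filter.Eventually.of_forall fun x => Finset.prod_nonneg fun i _ => hf i _),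
    integral_fintype_prod_eq_prod, ENNReal.ofReal_prod_of_nonneg
      fun i _ => integral_nonneg (hf i)]
  refine Finset.prod_congr rfl fun i _ => ?_
  exact ofReal_integral_eq_lintegral_ofReal (hint i) (Filter.Eventually.of_forall (hf i))

theorem lintegral_exp_dotProduct_gaussian (v : ℝ≥0) (c : ι → ℝ) :
    ∫⁻ x, ENNReal.ofReal (Real.exp (c ⬝ᵥ x)) ∂Measure.pi (fun _ : ι => gaussianReal 0 v) =
      ENNReal.ofReal (Real.exp (v * (c ⬝ᵥ c) / 2)) := by
  simp only [dotProduct, Real.exp_sum]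
  rw [lintegral_prod_pi (f := fun i x => Real.exp (c i * x)) _ (fun i x => (Real.exp_pos _).le)
    fun i => integrable_exp_mul_gaussianReal (c i)]
  simp only [lintegral_exp_mul_gaussianReal]
  rw [← ENNReal.ofReal_prod_of_nonneg fun i _ => (Real.exp_pos _).le, ← Real.exp_sum,
    Finset.mul_sum, Finset.sum_div]
  simp only [sq]

theorem integrable_exp_sq_gaussianReal {a : ℝ} (ha : a < 1) :
    Integrable (fun x => Real.exp (a * x ^ 2 / 2)) (gaussianReal 0 1) := by
  refine ⟨by fun_prop, ?_⟩
  rw [hasFiniteIntegral_iff_ofReal (Filter.Eventually.of_forall fun _ => (Real.exp_pos _).le),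
    lintegral_exp_sq_gaussianReal ha]
  exact ENNReal.ofReal_lt_top

theorem lintegral_exp_norm_sq_gaussian {a : ℝ} (ha : a < 1) :
    ∫⁻ x, ENNReal.ofReal (Real.exp (a * (x ⬝ᵥ x) / 2))
      ∂Measure.pi (fun _ : ι => gaussianReal 0 1) =
      ENNReal.ofReal ((√(1 - a))⁻¹ ^ Fintype.card ι) := by
  simp only [dotProduct, Finset.mul_sum, Finset.sum_div, Real.exp_sum, ← sq]
  rw [lintegral_prod_pi (f := fun _ x => Real.exp (a * x ^ 2 / 2)) _
    (fun i x => (Real.exp_pos _).le) fun i => integrable_exp_sq_gaussianReal ha]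
  simp only [lintegral_exp_sq_gaussianReal ha, Finset.prod_const, Finset.card_univ]
  rw [← ENNReal.ofReal_pow (by positivity)]

/-- The exponential moment of the squared norm of a linear image of a Gaussian vector, by
linearisation with an auxiliary Gaussian vector. -/
theorem lintegral_exp_norm_sq_mulVec_le (M : Matrix κ ι ℝ) (v : ℝ≥0) {τ c : ℝ}
    (hτ : ∀ h : κ → ℝ, v * ((Mᵀ *ᵥ h) ⬝ᵥ (Mᵀ *ᵥ h)) ≤ τ * (h ⬝ᵥ h)) (hc : c ^ 2 * τ < 1) :
    ∫⁻ x, ENNReal.ofReal (Real.exp (c ^ 2 * ((M *ᵥ x) ⬝ᵥ (M *ᵥ x)) / 2))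
      ∂Measure.pi (fun _ : ι => gaussianReal 0 v) ≤
      ENNReal.ofReal ((√(1 - c ^ 2 * τ))⁻¹ ^ Fintype.card κ) := by
  -- Linearisation: `exp(c² |Mx|² / 2)` is the mean of `exp(c ⟨h, Mx⟩)` over a standard Gaussian
  -- `h`. After exchanging the integrals, the one over `x` is again the exponential of a quadratic
  -- form, now in `h`.
  have h1 : ∀ x : ι → ℝ, ENNReal.ofReal (Real.exp (c ^ 2 * ((M *ᵥ x) ⬝ᵥ (M *ᵥ x)) / 2)) =
      ∫⁻ h, ENNReal.ofReal (Real.exp (c * (h ⬝ᵥ (M *ᵥ x))))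
        ∂Measure.pi (fun _ : κ => gaussianReal 0 1) := by
    intro x
    have := lintegral_exp_dotProduct_gaussian (ι := κ) 1 (c • (M *ᵥ x))
    simp only [smul_dotProduct, dotProduct_smul, smul_eq_mul, NNReal.coe_one, one_mul,
      dotProduct_comm (M *ᵥ x)] at this
    rw [this]
    congr 2
    ring
  simp only [h1]
  rw [lintegral_lintegral_swap, ← lintegral_exp_norm_sq_gaussian (ι := κ) hc]
  · refine lintegral_mono fun h => ?_
    have := lintegral_exp_dotProduct_gaussian v (c • (Mᵀ *ᵥ h))
    simp only [smul_dotProduct, dotProduct_smul, smul_eq_mul] at this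
    have h2 : ∀ x, h ⬝ᵥ (M *ᵥ x) = (Mᵀ *ᵥ h) ⬝ᵥ x := fun x => by
      rw [Matrix.dotProduct_mulVec, Matrix.mulVec_transpose]
    simp only [h2]
    rw [this]
    refine ENNReal.ofReal_le_ofReal (Real.exp_le_exp.2 ?_)
    have := mul_le_mul_of_nonneg_left (hτ h) (sq_nonneg c)
    linarith
  · refine Measurable.aemeasurable ?_
    refine ENNReal.measurable_ofReal.comp (Real.measurable_exp.comp ?_)
    simp only [dotProduct, Matrix.mulVec]
    fun_prop

/-- The tail of the norm of a linear image of a Gaussian vector. -/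
theorem gaussian_norm_sq_mulVec_tail (M : Matrix κ ι ℝ) (v : ℝ≥0) {τ x : ℝ} (hτ0 : 0 < τ)
    (hx : 0 < x) (hκ : 0 < Fintype.card κ)
    (hτ : ∀ h : κ → ℝ, v * ((Mᵀ *ᵥ h) ⬝ᵥ (Mᵀ *ᵥ h)) ≤ τ * (h ⬝ᵥ h)) :
    Measure.pi (fun _ : ι => gaussianReal 0 v)
      {g | τ * Fintype.card κ * (1 + √(4 * x / Fintype.card κ)) ^ 2 <
        (M *ᵥ g) ⬝ᵥ (M *ᵥ g)} ≤ ENNReal.ofReal (Real.exp (-x)) := by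
  set T : ℝ := (Fintype.card κ : ℝ) with hT
  have hTpos : 0 < T := by rw [hT]; exact_mod_cast hκ
  set u : ℝ := 1 + √(4 * x / T) with hu
  have hs : 0 < √(4 * x / T) := Real.sqrt_pos.2 (by positivity)
  have hu1 : 1 < u := by linarith
  have hu0 : 0 < u := by linarith
  have husq : T * (u - 1) ^ 2 = 4 * x := by
    rw [hu, add_sub_cancel_left, Real.sq_sqrt (by positivity)]
    field_simp
  have hinv : (u ^ 2)⁻¹ < 1 := inv_lt_one_of_one_lt₀ (by nlinarith)
  -- This choice makes the moment bound `(1 - c²τ)^{-T/2}` equal to `u^T`.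
  set c : ℝ := √((1 - (u ^ 2)⁻¹) / τ) with hc
  have hcsq : c ^ 2 = (1 - (u ^ 2)⁻¹) / τ :=
    Real.sq_sqrt (div_nonneg (by linarith) hτ0.le)
  have hcτ : c ^ 2 * τ = 1 - (u ^ 2)⁻¹ := by rw [hcsq]; field_simp
  have h1 := lintegral_exp_norm_sq_mulVec_le M v hτ (c := c) (by
    rw [hcτ]; have : 0 < (u ^ 2)⁻¹ := by positivity
    linarith)
  have h2 : (√(1 - c ^ 2 * τ))⁻¹ = u := by
    rw [hcτ, sub_sub_cancel, Real.sqrt_inv, inv_inv, Real.sqrt_sq hu0.le]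
  rw [h2] at h1
  set P := Measure.pi (fun _ : ι => gaussianReal 0 v)
  have hsub : {g : ι → ℝ | τ * T * u ^ 2 < (M *ᵥ g) ⬝ᵥ (M *ᵥ g)} ⊆
      {g | ENNReal.ofReal (Real.exp (T * (u ^ 2 - 1) / 2)) ≤
        ENNReal.ofReal (Real.exp (c ^ 2 * ((M *ᵥ g) ⬝ᵥ (M *ᵥ g)) / 2))} := by
    intro g hg
    refine ENNReal.ofReal_le_ofReal (Real.exp_le_exp.2 ?_)
    have h3 := mul_le_mul_of_nonneg_left (le_of_lt hg) (sq_nonneg c)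
    have h4 : c ^ 2 * (τ * T * u ^ 2) = T * (u ^ 2 - 1) := by
      rw [← mul_assoc, ← mul_assoc, hcτ]
      field_simp
    linarith
  have hmark := meas_ge_le_lintegral_div (μ := P)
    (f := fun g => ENNReal.ofReal (Real.exp (c ^ 2 * ((M *ᵥ g) ⬝ᵥ (M *ᵥ g)) / 2)))
    (Measurable.aemeasurable (by
      refine ENNReal.measurable_ofReal.comp (Real.measurable_exp.comp ?_)
      simp only [dotProduct, Matrix.mulVec]
      fun_prop))
    (ε := ENNReal.ofReal (Real.exp (T * (u ^ 2 - 1) / 2)))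
    (ENNReal.ofReal_pos.2 (Real.exp_pos _)).ne' ENNReal.ofReal_ne_top
  refine (measure_mono hsub).trans (hmark.trans ((ENNReal.div_le_div_right h1 _).trans ?_))
  rw [← ENNReal.ofReal_div_of_pos (Real.exp_pos _)]
  refine ENNReal.ofReal_le_ofReal ?_
  -- By `log u ≤ u - 1` the exponent `T (log u - (u² - 1) / 2)` is at most `-T (u - 1)² / 2 = -2x`,
  -- which is more than enough.
  have hlog : Real.log u ≤ u - 1 := Real.log_le_sub_one_of_pos hu0
  have hpow : u ^ Fintype.card κ = Real.exp (T * Real.log u) := by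
    rw [hT, Real.exp_nat_mul, Real.exp_log hu0]
  rw [hpow, ← Real.exp_sub]
  refine Real.exp_le_exp.2 ?_
  have := mul_le_mul_of_nonneg_left hlog hTpos.le
  nlinarith

end GaussianTail

/-! ### The event on which the noise is small in every group. -/

section NoiseEvent

theorem dotProduct_mulVec_le_opNorm {κ : Type*} [Fintype κ] [DecidableEq κ] (A : Matrix κ κ ℝ)
    (h : κ → ℝ) : h ⬝ᵥ (A *ᵥ h) ≤ ‖Matrix.toEuclideanCLM (𝕜 := ℝ) A‖ * (h ⬝ᵥ h) := by
  have h1 := real_inner_le_norm (Matrix.toEuclideanCLM (𝕜 := ℝ) A (WithLp.toLp 2 h))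
    (WithLp.toLp 2 h)
  have h2 := (Matrix.toEuclideanCLM (𝕜 := ℝ) A).le_opNorm (WithLp.toLp 2 h)
  have h3 : ‖WithLp.toLp 2 h‖ * ‖WithLp.toLp 2 h‖ = h ⬝ᵥ h := by
    rw [← sq, EuclideanSpace.norm_sq_eq, dotProduct]
    simp [sq]
  have h4 : inner ℝ (Matrix.toEuclideanCLM (𝕜 := ℝ) A (WithLp.toLp 2 h)) (WithLp.toLp 2 h) =
      h ⬝ᵥ (A *ᵥ h) := by
    rw [Matrix.toEuclideanCLM_toLp, EuclideanSpace.inner_toLp_toLp]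
    simp
  rw [← h4, ← h3]
  refine h1.trans ?_
  rw [← mul_assoc]
  exact mul_le_mul_of_nonneg_right h2 (norm_nonneg _)

variable {V : Type*} [Fintype V] (G : SimpleGraph V) {n : ℕ}

open scoped Classical in
theorem blockOpNorm_nonneg (X : Matrix (Fin n) V ℝ) (j : G.ConnectedComponent) :
    0 ≤ blockOpNorm G X j := by
  exact norm_nonneg (Matrix.toEuclideanCLM (𝕜 := ℝ) _)

open scoped Classical in
-- For `M = X_jᵀ` one has `M Mᵀ = n Ψ[j, j]`; this is the variance bound required by the Gaussian
-- tail estimate.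
theorem dotProduct_block_le (X : Matrix (Fin n) V ℝ) (j : G.ConnectedComponent)
    (h : Group G j → ℝ) :
    ((Xᵀ.submatrix (fun v : Group G j => (v : V)) id)ᵀ *ᵥ h) ⬝ᵥ
      ((Xᵀ.submatrix (fun v : Group G j => (v : V)) id)ᵀ *ᵥ h) ≤
      n * blockOpNorm G X j * (h ⬝ᵥ h) := by
  set M := Xᵀ.submatrix (fun v : Group G j => (v : V)) id
  have h1 : (n : ℝ) • (gram X).submatrix (fun v : Group G j => (v : V))
      (fun v : Group G j => (v : V)) = M * Mᵀ := by
    ext v w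
    rcases Nat.eq_zero_or_pos n with hn | hn
    · subst hn; simp [Matrix.mul_apply]
    · have : (n : ℝ) ≠ 0 := by positivity
      simp [M, gram, Matrix.mul_apply, this]
  have h2 : (Mᵀ *ᵥ h) ⬝ᵥ (Mᵀ *ᵥ h) = h ⬝ᵥ ((M * Mᵀ) *ᵥ h) := by
    rw [← Matrix.mulVec_mulVec, Matrix.dotProduct_mulVec h M, Matrix.mulVec_transpose]
  rw [h2, ← h1, Matrix.smul_mulVec, dotProduct_smul, smul_eq_mul, mul_assoc]
  exact mul_le_mul_of_nonneg_left (dotProduct_mulVec_le_opNorm _ h) (Nat.cast_nonneg n)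

theorem le_noiseLevel (X : Matrix (Fin n) V ℝ) (η : ℝ) (j : G.ConnectedComponent) :
    √(blockOpNorm G X j) * (1 + √(4 * Real.log η⁻¹ / (groupSize G j : ℝ))) ≤ noiseLevel G X η :=
  le_ciSup (f := fun j => √(blockOpNorm G X j) *
    (1 + √(4 * Real.log η⁻¹ / (groupSize G j : ℝ)))) (Set.finite_range _).bddAbove j

open scoped Classical in
theorem groupNorm_transpose_sq (X : Matrix (Fin n) V ℝ) (g : Fin n → ℝ)
    (j : G.ConnectedComponent) :
    groupNorm G (Xᵀ *ᵥ g) j ^ 2 =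
      (Xᵀ.submatrix (fun v : Group G j => (v : V)) id *ᵥ g) ⬝ᵥ
        (Xᵀ.submatrix (fun v : Group G j => (v : V)) id *ᵥ g) := by
  unfold groupNorm
  rw [l2_sq, dotProduct]
  simp only [sq]
  rfl

theorem group_noise_tail (X : Matrix (Fin n) V ℝ) (hn : 0 < n) (σ : ℝ≥0) {η lam : ℝ}
    (hη : 0 < η) (hη1 : η < 1) (hlam : 0 < lam)
    (h : 2 * (σ : ℝ) / √(n : ℝ) * noiseLevel G X η ≤ lam) (j : G.ConnectedComponent) :
    Measure.pi (fun _ : Fin n => gaussianReal 0 (σ ^ 2))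
      {g | n * lam / 2 * √(groupSize G j : ℝ) < groupNorm G (Xᵀ *ᵥ g) j} ≤
        ENNReal.ofReal η := by
  classical
  have hn' : (0 : ℝ) < n := by exact_mod_cast hn
  have hsn : 0 < √(n : ℝ) := Real.sqrt_pos.2 hn'
  have hx : 0 < Real.log η⁻¹ := Real.log_pos ((one_lt_inv₀ hη).2 hη1)
  have hcard : Fintype.card (Group G j) = groupSize G j := by
    rw [groupSize, Nat.card_eq_fintype_card]
  set u := 1 + √(4 * Real.log η⁻¹ / (groupSize G j : ℝ)) with hu
  have hu0 : 0 < u := by positivity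
  -- Defined from `λ` and not from the variance, so that it is positive even when `σ` or the block
  -- vanishes; `τ T_j u²` is then exactly the squared level `(n λ / 2)² T_j`.
  set τ := (n * lam / (2 * u)) ^ 2 with hτ
  have hτ0 : 0 < τ := by positivity
  have hop := blockOpNorm_nonneg G X j
  have hroot : (σ : ℝ) * √(n : ℝ) * √(blockOpNorm G X j) ≤ n * lam / (2 * u) := by
    have h1 : 2 * (σ : ℝ) / √(n : ℝ) * (√(blockOpNorm G X j) * u) ≤ lam :=
      (mul_le_mul_of_nonneg_left (le_noiseLevel G X η j) (by positivity)).trans h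
    rw [le_div_iff₀ (by positivity)]
    calc (σ : ℝ) * √(n : ℝ) * √(blockOpNorm G X j) * (2 * u)
        = (√(n : ℝ) * √(n : ℝ)) * (2 * (σ : ℝ) / √(n : ℝ) * (√(blockOpNorm G X j) * u)) := by
          field_simp
      _ ≤ (√(n : ℝ) * √(n : ℝ)) * lam := mul_le_mul_of_nonneg_left h1 (by positivity)
      _ = n * lam := by rw [Real.mul_self_sqrt hn'.le]
  have hvar : ((σ ^ 2 : ℝ≥0) : ℝ) * (n * blockOpNorm G X j) ≤ τ := by
    have := pow_le_pow_left₀ (by positivity) hroot 2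
    rw [mul_pow, mul_pow, Real.sq_sqrt hn'.le, Real.sq_sqrt hop] at this
    rw [NNReal.coe_pow, ← mul_assoc]
    exact this
  have key := gaussian_norm_sq_mulVec_tail
    (Xᵀ.submatrix (fun v : Group G j => (v : V)) id) (σ ^ 2) hτ0 hx
    (hcard ▸ groupSize_pos G j) (fun h => by
      calc _ ≤ ((σ ^ 2 : ℝ≥0) : ℝ) * (n * blockOpNorm G X j * (h ⬝ᵥ h)) :=
            mul_le_mul_of_nonneg_left (dotProduct_block_le G X j h) (NNReal.coe_nonneg _)
        _ = ((σ ^ 2 : ℝ≥0) : ℝ) * (n * blockOpNorm G X j) * (h ⬝ᵥ h) := by ring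
        _ ≤ τ * (h ⬝ᵥ h) := mul_le_mul_of_nonneg_right hvar
            (Finset.sum_nonneg fun i _ => mul_self_nonneg _))
  rw [hcard, ← hu, Real.exp_neg, Real.exp_log (inv_pos.2 hη), inv_inv] at key
  refine le_trans (measure_mono fun g hg => ?_) key
  have h2 := pow_lt_pow_left₀ (show n * lam / 2 * √(groupSize G j : ℝ) < _ from hg)
    (by positivity) two_ne_zero
  rw [groupNorm_transpose_sq, mul_pow, Real.sq_sqrt (Nat.cast_nonneg _)] at h2
  refine lt_of_eq_of_lt ?_ h2
  rw [hτ]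
  field_simp

/-- With high probability all the groups of `Xᵀ ε` are bounded. -/
theorem exists_noise_event {Ω : Type*} [MeasurableSpace Ω] (P : Measure Ω) [IsProbabilityMeasure P]
    (X : Matrix (Fin n) V ℝ) (σ : ℝ≥0) (noise : Fin n → Ω → ℝ)
    (hmeas : ∀ i, Measurable (noise i)) (hindep : iIndepFun noise P)
    (hlaw : ∀ i, P.map (noise i) = gaussianReal 0 (σ ^ 2)) {η lam : ℝ}
    (hη : 0 < η) (hη1 : η < 1) (hlam : 0 < lam)
    (h : 2 * (σ : ℝ) / √(n : ℝ) * noiseLevel G X η ≤ lam) :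
    ∃ E : Set Ω, MeasurableSet E ∧ 1 - (Nat.card G.ConnectedComponent : ℝ) * η ≤ P.real E ∧
      ∀ ω ∈ E, ∀ j, groupNorm G (Xᵀ *ᵥ fun i => noise i ω) j ≤
        n * lam / 2 * √(groupSize G j : ℝ) := by
  classical
  have := Fintype.ofFinite G.ConnectedComponent
  rcases Nat.eq_zero_or_pos n with hn | hn
  · subst hn
    refine ⟨Set.univ, MeasurableSet.univ, ?_, fun ω _ j => ?_⟩
    · rw [probReal_univ]
      have : 0 ≤ (Nat.card G.ConnectedComponent : ℝ) * η := by positivity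
      linarith
    · rw [groupNorm_eq_sqrt, Finset.sum_eq_zero]
      · simp
      · intro v _; simp [Matrix.mulVec, dotProduct]
  have hjoint : P.map (fun ω i => noise i ω) =
      Measure.pi (fun _ : Fin n => gaussianReal 0 (σ ^ 2)) := by
    rw [(iIndepFun_iff_map_fun_eq_pi_map fun i => (hmeas i).aemeasurable).1 hindep]
    simp only [hlaw]
  set B : G.ConnectedComponent → Set (Fin n → ℝ) := fun j =>
    {g | n * lam / 2 * √(groupSize G j : ℝ) < groupNorm G (Xᵀ *ᵥ g) j} with hB
  have hBmeas : ∀ j, MeasurableSet (B j) := by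
    intro j
    refine measurableSet_lt measurable_const ?_
    simp only [groupNorm_eq_sqrt, Matrix.mulVec, dotProduct]
    fun_prop
  have hmeas' : Measurable fun ω i => noise i ω := measurable_pi_lambda _ hmeas
  have hBad : MeasurableSet ((fun ω i => noise i ω) ⁻¹' ⋃ j, B j) :=
    hmeas' (MeasurableSet.iUnion hBmeas)
  refine ⟨((fun ω i => noise i ω) ⁻¹' ⋃ j, B j)ᶜ, hBad.compl, ?_, ?_⟩
  · rw [probReal_compl_eq_one_sub hBad]
    refine sub_le_sub_left ?_ 1
    refine ENNReal.toReal_le_of_le_ofReal (by positivity) ?_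
    rw [← Measure.map_apply hmeas' (MeasurableSet.iUnion hBmeas), hjoint]
    calc _ ≤ ∑ j, Measure.pi (fun _ : Fin n => gaussianReal 0 (σ ^ 2)) (B j) :=
          measure_iUnion_fintype_le _ _
      _ ≤ ∑ _j : G.ConnectedComponent, ENNReal.ofReal η :=
          Finset.sum_le_sum fun j _ => group_noise_tail G X hn σ hη hη1 hlam h j
      _ = ENNReal.ofReal ((Nat.card G.ConnectedComponent : ℝ) * η) := by
          rw [Finset.sum_const, nsmul_eq_mul, ENNReal.ofReal_mul (Nat.cast_nonneg _),
            ENNReal.ofReal_natCast, Nat.card_eq_fintype_card, Finset.card_univ]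
  · intro ω hω j
    by_contra hcon
    exact hω (Set.mem_iUnion.2 ⟨j, not_le.1 hcon⟩)

end NoiseEvent

/-! ### First order condition and basic inequality for a minimiser. -/

section Minimizer

variable {V : Type*} [Fintype V] {n : ℕ} {X : Matrix (Fin n) V ℝ} {t lam ε : ℝ} {βs : V → ℝ} {noise : Fin n → ℝ}

/-- The ball is a sublevel set of the Gram form of the error, so any move which does not increase
that form is feasible. -/
theorem mem_predBall_of_gramForm_le {b b' : V → ℝ} (hb : b ∈ predBall X βs ε)
    (h : gramForm X (b' - βs) (b' - βs) ≤ gramForm X (b - βs) (b - βs)) :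
    b' ∈ predBall X βs ε := by
  refine le_trans ?_ (show (√(n : ℝ))⁻¹ * l2 (X *ᵥ (b - βs)) ≤ ε from hb)
  have key : ∀ x : V → ℝ, gramForm X x x = ((√(n : ℝ))⁻¹ * l2 (X *ᵥ x)) ^ 2 := fun x => by
    rw [gramForm_self, mul_pow, inv_pow, Real.sq_sqrt (Nat.cast_nonneg _)]
  rw [key, key] at h
  exact le_of_sq_le_sq h (mul_nonneg (by positivity) (l2_nonneg _))

variable [DecidableEq V] (G : SimpleGraph V) [DecidableRel G.Adj]

theorem objective_eq (X : Matrix (Fin n) V ℝ) (t lam : ℝ) (βs d : V → ℝ) (noise : Fin n → ℝ) :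
    objective G X (X *ᵥ βs + noise) t lam (βs + d) =
      (n : ℝ)⁻¹ * (noise ⬝ᵥ noise) / 2 - (n : ℝ)⁻¹ * ((Xᵀ *ᵥ noise) ⬝ᵥ d) + gramForm X d d / 2 +
        lam * penalty G t (βs + d) := by
  have h1 : X *ᵥ βs + noise - X *ᵥ (βs + d) = noise - X *ᵥ d := by
    rw [Matrix.mulVec_add]; abel
  have h2 : ∀ z : Fin n → ℝ, l2 z ^ 2 = z ⬝ᵥ z := fun z => by
    rw [l2_sq, dotProduct]; simp only [sq]
  have h3 : (Xᵀ *ᵥ noise) ⬝ᵥ d = noise ⬝ᵥ (X *ᵥ d) := by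
    rw [Matrix.dotProduct_mulVec, Matrix.mulVec_transpose]
  rw [objective, h1, h2, gramForm_eq_dotProduct, h3, sub_dotProduct, dotProduct_sub,
    dotProduct_sub, dotProduct_comm (X *ᵥ d) noise, one_div, mul_inv]
  ring

/-- The first order condition for a minimiser over the ball: the constraint can only make the
Gram form of the error smaller. -/
theorem abs_gramForm_single_le (hK : ∀ v w, 0 ≤ heatKernel G t v w) {φ : ℝ} (hφ : 0 < φ)
    (hlam : 0 < lam) (hdiag : ∀ v, gram X v v = φ) {d : V → ℝ}
    (hd : βs + d ∈ predBall X βs ε)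
    (hmin : IsMinOn (objective G X (X *ᵥ βs + noise) t lam) (predBall X βs ε) (βs + d)) (v : V) :
    |gramForm X (Pi.single v 1) d| ≤ (n : ℝ)⁻¹ * |(Xᵀ *ᵥ noise) v| +
      lam * √(groupSize G (G.connectedComponentMk v) : ℝ) := by
  set g := gramForm X (Pi.single v 1) d with hg
  set z := (Xᵀ *ᵥ noise) v with hz
  set T := √(groupSize G (G.connectedComponentMk v) : ℝ)
  have hT : 0 ≤ T := Real.sqrt_nonneg _
  rcases eq_or_ne g 0 with h0 | h0
  · rw [h0, abs_zero]; positivity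
  -- The slack `δ` absorbs the second order term, which replaces a passage to the limit in the step
  -- size.
  refine le_of_forall_pos_le_add fun δ hδ => ?_
  have hg0 : 0 < |g| := abs_pos.2 h0
  -- The sign for which moving along `e_v` decreases the Gram form to first order.
  obtain ⟨c, hc, hcg⟩ : ∃ c : ℝ, |c| = 1 ∧ c * g = -|g| := by
    rcases le_total 0 g with h | h
    · exact ⟨-1, by simp, by rw [abs_of_nonneg h]; ring⟩
    · exact ⟨1, by simp, by rw [abs_of_nonpos h]; ring⟩
  -- The first bound gives `τ² φ ≤ 2 τ |g|`, which keeps the new point in the ball; the second gives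
  -- `τ² φ / 2 ≤ τ δ`.
  set τ := min (2 * |g| / φ) (2 * δ / φ) with hτ
  have hτ0 : 0 < τ := lt_min (by positivity) (by positivity)
  have hτg : τ * φ ≤ 2 * |g| := (le_div_iff₀ hφ).1 (min_le_left _ _)
  have hτδ : τ * φ ≤ 2 * δ := (le_div_iff₀ hφ).1 (min_le_right _ _)
  set f : V → ℝ := (τ * c) • Pi.single v 1 with hf
  have hcc : c * c = 1 := by rw [← abs_mul_abs_self, hc, one_mul]
  have hself : gramForm X (Pi.single v 1) (Pi.single v 1) = φ := by
    rw [gramForm, Finset.sum_eq_single v, Finset.sum_eq_single v]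
    · simp [hdiag]
    · intro w _ hw; simp [hw]
    · simp
    · intro w _ hw; simp [hw]
    · simp
  have hff : gramForm X f f = τ ^ 2 * φ := by
    rw [hf, gramForm_smul_left, gramForm_symm, gramForm_smul_left, hself]
    linear_combination τ ^ 2 * φ * hcc
  have hfd : gramForm X f d = -(τ * |g|) := by
    rw [hf, gramForm_smul_left, ← hg, mul_assoc, hcg]; ring
  have hexp : gramForm X (d + f) (d + f) = gramForm X d d - 2 * (τ * |g|) + τ ^ 2 * φ := by
    rw [gramForm_add_left, gramForm_symm X d, gramForm_symm X f, gramForm_add_left,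
      gramForm_add_left, hff, gramForm_symm X d f, hfd]
    ring
  have hmem : βs + (d + f) ∈ predBall X βs ε := by
    refine mem_predBall_of_gramForm_le hd ?_
    rw [add_sub_cancel_left, add_sub_cancel_left, hexp]
    nlinarith
  have hle := hmin hmem
  simp only [Set.mem_ofPred_eq, objective_eq, hexp, dotProduct_add] at hle
  have hzf : (Xᵀ *ᵥ noise) ⬝ᵥ f = τ * (c * z) := by
    rw [hf, dotProduct_smul, dotProduct_single, smul_eq_mul, mul_one, ← hz, mul_assoc]
  have hczabs : -(c * z) ≤ |z| := by
    have := neg_le_abs (c * z)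
    rwa [abs_mul, hc, one_mul] at this
  have hpen : penalty G t (βs + (d + f)) ≤ penalty G t (βs + d) + τ * T := by
    rw [← add_assoc]
    refine (penalty_add_le G hK _ _).trans ?_
    gcongr
    rw [hf, penalty_smul G hK, abs_mul, hc, mul_one, abs_of_pos hτ0]
    refine mul_le_mul_of_nonneg_left ?_ hτ0.le
    simpa using penalty_single_le G hK v 1
  rw [hzf] at hle
  have hpen' := mul_le_mul_of_nonneg_left hpen hlam.le
  have hzn := mul_le_mul_of_nonneg_left hczabs (inv_nonneg.2 (Nat.cast_nonneg (α := ℝ) n))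
  have hfin : τ * |g| ≤ τ * ((n : ℝ)⁻¹ * |z| + lam * T + δ) := by
    have h1 := mul_le_mul_of_nonneg_left hzn hτ0.le
    have h2 := mul_le_mul_of_nonneg_left hτδ hτ0.le
    nlinarith
  exact le_of_mul_le_mul_left hfin hτ0

variable [Fintype G.ConnectedComponent]

/-- The basic inequality for a minimiser. -/
theorem gramForm_self_add_le {r : ℝ} (hK0 : ∀ v w, 0 ≤ heatKernel G t v w)
    (hK : ∀ v w, G.connectedComponentMk v = G.connectedComponentMk w →
      r ^ 2 / (groupSize G (G.connectedComponentMk v) : ℝ) ≤ heatKernel G t v w)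
    (hlam : 0 < lam)
    (hnoise : ∀ j, groupNorm G (Xᵀ *ᵥ noise) j ≤ n * lam / 2 * √(groupSize G j : ℝ))
    {d : V → ℝ} (hmin : objective G X (X *ᵥ βs + noise) t lam (βs + d) ≤
      objective G X (X *ᵥ βs + noise) t lam βs) :
    gramForm X d d / 2 + lam * (r * ∑ j, √(groupSize G j : ℝ) *
        groupNorm G (restrict G (activeSet G βs)ᶜ d) j) ≤
      lam / 2 * ∑ j, √(groupSize G j : ℝ) * groupNorm G d j +
        lam * ∑ j, √(groupSize G j : ℝ) * groupNorm G (restrict G (activeSet G βs) d) j := by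
  have h0 := objective_eq G X t lam βs 0 noise
  rw [objective_eq] at hmin
  have hz : gramForm X (0 : V → ℝ) 0 = 0 := by simp [gramForm]
  rw [add_zero, hz, dotProduct_zero] at h0
  rw [h0] at hmin
  have h1 : (n : ℝ)⁻¹ * ((Xᵀ *ᵥ noise) ⬝ᵥ d) ≤
      lam / 2 * ∑ j, √(groupSize G j : ℝ) * groupNorm G d j := by
    have h2 : (Xᵀ *ᵥ noise) ⬝ᵥ d ≤
        n * (lam / 2 * ∑ j, √(groupSize G j : ℝ) * groupNorm G d j) := by
      refine (sum_mul_le_groupNorm G _ _).trans ?_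
      rw [Finset.mul_sum, Finset.mul_sum]
      refine Finset.sum_le_sum fun j _ => ?_
      refine (mul_le_mul_of_nonneg_right (hnoise j) (groupNorm_nonneg G d j)).trans_eq ?_
      ring
    have hS : 0 ≤ lam / 2 * ∑ j, √(groupSize G j : ℝ) * groupNorm G d j :=
      mul_nonneg (by positivity) (Finset.sum_nonneg fun j _ =>
        mul_nonneg (Real.sqrt_nonneg _) (groupNorm_nonneg G d j))
    -- For `n = 0` the factor `n⁻¹` is 0 and the noise term disappears.
    rcases Nat.eq_zero_or_pos n with hn | hn
    · rw [show (n : ℝ)⁻¹ = 0 by rw [hn]; simp, zero_mul]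
      exact hS
    · rwa [inv_mul_le_iff₀ (by exact_mod_cast hn)]
  have h3 := penalty_sub_penalty_add_le G hK0 βs d
  have h4 := penalty_le G hK0 (restrict G (activeSet G βs) d)
  have h5 := le_penalty G hK (restrict G (activeSet G βs)ᶜ d)
  have h6 := mul_le_mul_of_nonneg_left (h3.trans (sub_le_sub h4 h5)) hlam.le
  linarith

end Minimizer

/-! ### Lower bound for the Gram form by the active part. -/

section Restricted

variable {V : Type*} [Fintype V] (G : SimpleGraph V)

theorem groupNorm_eq_add_restrict (A : Set G.ConnectedComponent) (x : V → ℝ)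
    (j : G.ConnectedComponent) :
    groupNorm G x j = groupNorm G (restrict G A x) j + groupNorm G (restrict G Aᶜ x) j := by
  by_cases hj : j ∈ A
  · rw [groupNorm_restrict_of_mem G x hj, groupNorm_restrict_of_notMem G x (not_not.2 hj), add_zero]
  · rw [groupNorm_restrict_of_notMem G x hj,
      groupNorm_restrict_of_mem G x (show j ∈ Aᶜ from hj), zero_add]

variable [Fintype G.ConnectedComponent]

/-- Cauchy–Schwarz over at most `s` groups; the factor `s` is compensated by the `1 / s` in the
coherence level. -/
theorem sq_sum_groupNorm_restrict_le (A : Set G.ConnectedComponent) {s : ℕ} (hA : A.ncard ≤ s)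
    (x : V → ℝ) : (∑ j, groupNorm G (restrict G A x) j) ^ 2 ≤ s * ∑ v, restrict G A x v ^ 2 := by
  classical
  have h1 : ∑ j, groupNorm G (restrict G A x) j =
      ∑ j ∈ A.toFinset, groupNorm G (restrict G A x) j := by
    refine (Finset.sum_subset (Finset.subset_univ _) fun j _ hj => ?_).symm
    exact groupNorm_restrict_of_notMem G x (by simpa using hj)
  have h2 : ∑ v, restrict G A x v ^ 2 = ∑ j, groupNorm G (restrict G A x) j ^ 2 := by
    rw [← sum_groupVerts G]
    simp only [groupNorm_sq]
  rw [h1, h2]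
  refine (sq_sum_le_card_mul_sum_sq).trans ?_
  rw [← Set.ncard_eq_toFinset_card']
  refine mul_le_mul (by exact_mod_cast hA) ?_ (Finset.sum_nonneg fun j _ => sq_nonneg _)
    (Nat.cast_nonneg _)
  exact Finset.sum_le_sum_of_subset_of_nonneg (Finset.subset_univ _) fun j _ _ => sq_nonneg _

variable {n : ℕ} {X : Matrix (Fin n) V ℝ} {e : GroupLabelling G} {s : ℕ} {α φ : ℝ}

/-- The lower bound of the Gram form by the part of the vector in a set of groups. -/
theorem le_gramForm_self (hX : BlockCoherence G X e s α φ) (hμ : 0 ≤ coherenceLevel G s α φ)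
    (A : Set G.ConnectedComponent) (x : V → ℝ) :
    φ * ∑ v, restrict G A x v ^ 2 -
      2 * coherenceLevel G s α φ * (∑ j, groupNorm G (restrict G A x) j) ^ 2 -
      4 * coherenceLevel G s α φ * (∑ j, groupNorm G (restrict G A x) j) *
        ∑ j, groupNorm G (restrict G Aᶜ x) j ≤ gramForm X x x := by
  have h1 := (abs_le.1 (abs_gramForm_sub_le G hX hμ (restrict G A x) (restrict G A x))).1
  have h2 := (abs_le.1 (abs_gramForm_sub_le G hX hμ (restrict G A x) (restrict G Aᶜ x))).1
  have h3 : ∑ v, restrict G A x v * restrict G Aᶜ x v = 0 := by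
    refine Finset.sum_eq_zero fun v _ => ?_
    by_cases hv : G.connectedComponentMk v ∈ A
    · rw [restrict_of_notMem G x (A := Aᶜ) (not_not.2 hv), mul_zero]
    · rw [restrict_of_notMem G x hv, zero_mul]
  have h4 : gramForm X x x = gramForm X (restrict G A x) (restrict G A x) +
      2 * gramForm X (restrict G A x) (restrict G Aᶜ x) +
      gramForm X (restrict G Aᶜ x) (restrict G Aᶜ x) := by
    conv_lhs => rw [← restrict_add_restrict_compl G A x]
    rw [gramForm_add_left, gramForm_symm X (restrict G A x), gramForm_symm X (restrict G Aᶜ x),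
      gramForm_add_left, gramForm_add_left,
      gramForm_symm X (restrict G Aᶜ x) (restrict G A x)]
    ring
  -- The inactive block is dropped by positivity. The cross term has no `φ` part, the supports being
  -- disjoint, and it occurs twice, whence the 4.
  have h5 := gramForm_self_nonneg X (restrict G Aᶜ x)
  rw [h3] at h2
  simp only [← sq] at h1
  rw [h4]
  linarith

end Restricted

/-! ### From the cone condition to the bound in the maximum norm. -/

section SupportRecovery

/-- The numerical part of the passage from the cone condition to the bound in the maximum norm. -/
theorem coherence_mul_le {a c SA Sc D q M m s μ φ α γ r lam : ℝ} (hα : 1 < α) (hφ : 0 < φ)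
    (hlam : 0 < lam) (hm : 0 < m) (hmM : m ≤ M) (hs : 0 < s) (hμ : μ = m * φ / (14 * α * M * s))
    (hγ : 3 < γ) (hr : (2 * r - 1) * γ = 3)
    (hγα : 42 * (1 + γ) * (α - 1) ≤ 16 * (14 * α - 2 - 4 * γ))
    (ha : 0 ≤ a) (hSc : 0 ≤ Sc) (hq : 0 ≤ q)
    (h1 : q / 2 + lam * (r * Sc) ≤ lam / 2 * (SA + Sc) + lam * SA)
    (hSA : SA ≤ M * a) (hmc : m * c ≤ Sc) (hD : a ^ 2 ≤ s * D)
    (h4 : φ * D - 2 * μ * a ^ 2 - 4 * μ * a * c ≤ q) :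
    2 * μ * (a + c) ≤ 16 / (7 * (α - 1)) * lam * M := by
  have hM : 0 < M := hm.trans_le hmM
  have hα0 : 0 < α := by linarith
  -- In this unit `μ = m k` and `φ = 14 α M k s`. The factor `m` turns `c` into the weighted norm
  -- `Sc`, and the factor `s` meets `a² ≤ s D`.
  set k := φ / (14 * α * M * s) with hk
  have hk0 : 0 < k := by positivity
  have hμk : μ = m * k := by rw [hμ, hk]; ring
  have hφk : φ = 14 * α * M * k * s := by rw [hk]; field_simp
  have hr' : 0 < 2 * r - 1 := by
    by_contra hcon
    nlinarith
  have hγ0 : 0 < γ := by linarith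
  -- Dropping `q` from the basic inequality leaves `(2r - 1) Sc ≤ 3 SA`. Dropping `Sc` instead gives
  -- the bound on `q` below.
  have hcone : Sc ≤ γ * SA := by
    have h5 : lam * ((2 * r - 1) * Sc) ≤ lam * (3 * SA) := by linarith
    have h6 := le_of_mul_le_mul_left h5 hlam
    have h7 := mul_le_mul_of_nonneg_left h6 hγ0.le
    have h8 : γ * ((2 * r - 1) * Sc) = 3 * Sc := by linear_combination Sc * hr
    linarith
  have hmc' : m * c ≤ γ * (M * a) :=
    (hmc.trans hcone).trans (mul_le_mul_of_nonneg_left hSA hγ0.le)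
  have hq' : q ≤ 3 * lam * (M * a) := by
    have h5 : 0 ≤ lam * ((2 * r - 1) * Sc) := by positivity
    have h6 := mul_le_mul_of_nonneg_left hSA hlam.le
    linarith
  have hα1 : 0 < α - 1 := by linarith
  have hden : 0 < 14 * α - 2 - 4 * γ := by
    have : 0 < 42 * (1 + γ) * (α - 1) := by positivity
    linarith
  -- The quadratic lower bound is at least `M k a² (14α - 2 - 4γ)` and the upper bound on `q` is `3
  -- λ M a`. Cancelling `M a` requires `a ≠ 0`, so `a = 0` is treated apart.
  have hka : k * a * (14 * α - 2 - 4 * γ) ≤ 3 * lam := by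
    rcases ha.eq_or_lt with h0 | h0
    · rw [← h0]; simp; positivity
    · have e1 : 14 * α * M * k * a ^ 2 ≤ φ * D := by
        have := mul_le_mul_of_nonneg_left hD (show 0 ≤ 14 * α * M * k by positivity)
        rw [hφk]; linarith
      have e2 : 2 * μ * a ^ 2 ≤ 2 * M * k * a ^ 2 := by
        rw [hμk]
        have := mul_le_mul_of_nonneg_right hmM (show 0 ≤ 2 * k * a ^ 2 by positivity)
        linarith
      have e3 : 4 * μ * a * c ≤ 4 * k * a * (γ * (M * a)) := by
        rw [hμk]
        have := mul_le_mul_of_nonneg_left hmc' (show 0 ≤ 4 * k * a by positivity)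
        linarith
      have e4 : M * a * (k * a * (14 * α - 2 - 4 * γ)) ≤ M * a * (3 * lam) := by
        linarith
      exact le_of_mul_le_mul_left e4 (by positivity)
  have hfin : 2 * μ * (a + c) ≤ 2 * (1 + γ) * M * (k * a) := by
    rw [hμk]
    have e1 := mul_le_mul_of_nonneg_left hmc' (show 0 ≤ 2 * k by positivity)
    have e2 := mul_le_mul_of_nonneg_right hmM (show 0 ≤ 2 * k * a by positivity)
    linarith
  have hka' : k * a ≤ 3 * lam / (14 * α - 2 - 4 * γ) := (le_div_iff₀ hden).2 hka
  refine hfin.trans ((mul_le_mul_of_nonneg_left hka' (by positivity)).trans ?_)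
  rw [show 2 * (1 + γ) * M * (3 * lam / (14 * α - 2 - 4 * γ)) =
    (6 * (1 + γ) / (14 * α - 2 - 4 * γ)) * lam * M by ring]
  refine mul_le_mul_of_nonneg_right (mul_le_mul_of_nonneg_right ?_ hlam.le) hM.le
  rw [div_le_div_iff₀ hden (by positivity)]
  linarith

variable {V : Type*} (G : SimpleGraph V)

theorem Tmin_le_groupSize (j : G.ConnectedComponent) : Tmin G ≤ groupSize G j :=
  ciInf_le (f := groupSize G) (OrderBot.bddBelow _) j

variable [Fintype V]

theorem groupSize_le_Tmax (j : G.ConnectedComponent) : groupSize G j ≤ Tmax G :=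
  le_ciSup (f := groupSize G) (Set.finite_range _).bddAbove j

theorem Tmin_pos [Nonempty V] : 0 < Tmin G := by
  have : Nonempty G.ConnectedComponent := ⟨G.connectedComponentMk (Classical.arbitrary V)⟩
  obtain ⟨j, hj⟩ := Nat.sInf_mem (Set.range_nonempty (groupSize G))
  rw [Tmin, iInf, ← hj]
  exact groupSize_pos G j

theorem sum_groupNorm_single [DecidableEq V] [Fintype G.ConnectedComponent] (v : V) :
    ∑ j, groupNorm G (Pi.single v (1 : ℝ)) j = 1 := by
  rw [Finset.sum_eq_single (G.connectedComponentMk v)]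
  · rw [groupNorm_eq_sqrt, Finset.sum_eq_single v]
    · simp
    · intro w _ hw; simp [hw]
    · simp [mem_groupVerts]
  · intro j _ hj
    rw [groupNorm_eq_sqrt, Finset.sum_eq_zero, Real.sqrt_zero]
    intro w hw
    have : w ≠ v := by rintro rfl; exact hj ((mem_groupVerts G).1 hw).symm
    simp [this]
  · simp

/-- The bound on the error of a minimiser in the maximum norm, on the event that the noise is
bounded in all the groups. -/
theorem abs_error_le [DecidableEq V] [DecidableRel G.Adj] {n : ℕ} {X : Matrix (Fin n) V ℝ}
    {t lam ε : ℝ} {βs : V → ℝ} {noise : Fin n → ℝ} {e : GroupLabelling G} {s : ℕ}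
    {α φ γ r : ℝ} (hα : 1 < α) (hφ : 0 < φ) (hlam : 0 < lam) (hε : 0 < ε)
    (hγ : 3 < γ) (hr : (2 * r - 1) * γ = 3)
    (hγα : 42 * (1 + γ) * (α - 1) ≤ 16 * (14 * α - 2 - 4 * γ))
    (hK : ∀ v w, G.connectedComponentMk v = G.connectedComponentMk w →
      r ^ 2 / (groupSize G (G.connectedComponentMk v) : ℝ) ≤ heatKernel G t v w)
    (hs : 1 ≤ s) (hA : (activeSet G βs).ncard ≤ s) (hX : BlockCoherence G X e s α φ)
    (hnoise : ∀ j, groupNorm G (Xᵀ *ᵥ noise) j ≤ n * lam / 2 * √(groupSize G j : ℝ))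
    {b : V → ℝ} (hb : b ∈ predBall X βs ε)
    (hmin : IsMinOn (objective G X (X *ᵥ βs + noise) t lam) (predBall X βs ε) b) (v : V) :
    |b v - βs v| ≤ threshold G α φ lam := by
  have := Fintype.ofFinite G.ConnectedComponent
  have : Nonempty V := ⟨v⟩
  obtain ⟨d, rfl⟩ : ∃ d, b = βs + d := ⟨b - βs, by abel⟩
  rw [Pi.add_apply, add_sub_cancel_left]
  have hK0 : ∀ v w, 0 ≤ heatKernel G t v w := by
    intro v w
    by_cases h : G.connectedComponentMk v = G.connectedComponentMk w
    · exact le_trans (by positivity) (hK v w h)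
    · rw [heatKernel_eq_zero G t h]
  set A := activeSet G βs with hAdef
  set M := √(Tmax G : ℝ) with hM
  set m := √(Tmin G : ℝ) with hm
  have hm0 : 0 < m := Real.sqrt_pos.2 (by exact_mod_cast Tmin_pos G)
  have hTM : ∀ j, √(groupSize G j : ℝ) ≤ M := fun j =>
    Real.sqrt_le_sqrt (by exact_mod_cast groupSize_le_Tmax G j)
  have hTm : ∀ j, m ≤ √(groupSize G j : ℝ) := fun j =>
    Real.sqrt_le_sqrt (by exact_mod_cast Tmin_le_groupSize G j)
  have hmM : m ≤ M := (hTm (G.connectedComponentMk v)).trans (hTM _)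
  have hM0 : 0 < M := hm0.trans_le hmM
  have hμ : 0 ≤ coherenceLevel G s α φ := by
    unfold coherenceLevel
    have : 0 < α := by linarith
    positivity
  have hbase : βs ∈ predBall X βs ε := by
    change (√(n : ℝ))⁻¹ * l2 (X *ᵥ (βs - βs)) ≤ ε
    have h0 : l2 (0 : Fin n → ℝ) = 0 := by simp [l2]
    rw [sub_self, Matrix.mulVec_zero, h0, mul_zero]
    exact hε.le
  have hbasic := gramForm_self_add_le G hK0 hK hlam hnoise (hmin hbase)
  have hsplit : ∀ x : G.ConnectedComponent → ℝ, ∑ j, x j * groupNorm G d j =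
      ∑ j, x j * groupNorm G (restrict G A d) j + ∑ j, x j * groupNorm G (restrict G Aᶜ d) j := by
    intro x
    rw [← Finset.sum_add_distrib]
    refine Finset.sum_congr rfl fun j _ => ?_
    rw [groupNorm_eq_add_restrict G A, mul_add]
  rw [hsplit] at hbasic
  have hsum : ∑ j, groupNorm G d j =
      ∑ j, groupNorm G (restrict G A d) j + ∑ j, groupNorm G (restrict G Aᶜ d) j := by
    simpa using hsplit fun _ => 1
  have hcoh := coherence_mul_le hα hφ hlam hm0 hmM (s := s) (by exact_mod_cast hs)
    (μ := coherenceLevel G s α φ) rfl hγ hr hγα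
    (Finset.sum_nonneg fun j _ => groupNorm_nonneg G (restrict G A d) j)
    (Finset.sum_nonneg fun j _ => mul_nonneg (Real.sqrt_nonneg _) (groupNorm_nonneg G _ j))
    (gramForm_self_nonneg X d) hbasic
    (by
      rw [Finset.mul_sum]
      exact Finset.sum_le_sum fun j _ =>
        mul_le_mul_of_nonneg_right (hTM j) (groupNorm_nonneg G _ j))
    (by
      rw [Finset.mul_sum]
      exact Finset.sum_le_sum fun j _ =>
        mul_le_mul_of_nonneg_right (hTm j) (groupNorm_nonneg G _ j))
    (sq_sum_groupNorm_restrict_le G A hA d) (le_gramForm_self G hX hμ A d)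
  -- Tested against a unit vector, whose group norms sum to 1, coherence isolates the single
  -- coordinate `φ d_v`.
  have hsingle := abs_gramForm_sub_le G hX hμ (Pi.single v 1) d
  rw [sum_groupNorm_single, mul_one, hsum] at hsingle
  have hdv : ∑ w, (Pi.single v 1 : V → ℝ) w * d w = d v := by
    rw [Finset.sum_eq_single v]
    · simp
    · intro w _ hw; simp [hw]
    · simp
  rw [hdv] at hsingle
  have hfirst := abs_gramForm_single_le G hK0 hφ hlam hX.diag hb hmin v
  have hz : (n : ℝ)⁻¹ * |(Xᵀ *ᵥ noise) v| ≤ lam / 2 * M := by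
    have h1 : |(Xᵀ *ᵥ noise) v| ≤ groupNorm G (Xᵀ *ᵥ noise) (G.connectedComponentMk v) := by
      rw [groupNorm_eq_sqrt, ← Real.sqrt_sq_eq_abs]
      exact Real.sqrt_le_sqrt (Finset.single_le_sum
        (f := fun w => (Xᵀ *ᵥ noise) w ^ 2) (fun w _ => sq_nonneg _) ((mem_groupVerts G).2 rfl))
    have h2 : |(Xᵀ *ᵥ noise) v| ≤ n * (lam / 2 * M) := by
      refine (h1.trans (hnoise _)).trans ?_
      have := mul_le_mul_of_nonneg_left (hTM (G.connectedComponentMk v))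
        (show 0 ≤ n * lam / 2 by positivity)
      linarith
    rcases Nat.eq_zero_or_pos n with hn | hn
    · rw [show (n : ℝ)⁻¹ = 0 by rw [hn]; simp, zero_mul]
      positivity
    · rwa [inv_mul_le_iff₀ (by exact_mod_cast hn)]
  have hT := mul_le_mul_of_nonneg_left (hTM (G.connectedComponentMk v)) hlam.le
  have htri : φ * |d v| ≤ |gramForm X (Pi.single v 1) d| +
      |gramForm X (Pi.single v 1) d - φ * d v| := by
    rw [← abs_of_pos hφ, ← abs_mul, abs_of_pos hφ]
    have := abs_sub (gramForm X (Pi.single v 1) d) (gramForm X (Pi.single v 1) d - φ * d v)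
    rwa [sub_sub_cancel] at this
  -- The `3/2` in `cConst` is `1/2` from the noise plus 1 from the penalty; the remaining term
  -- bounds the coherence error.
  have hmain : φ * |d v| ≤ cConst α * lam * M := by
    rw [cConst]
    linarith
  rw [threshold, div_mul_eq_mul_div, div_mul_eq_mul_div, le_div_iff₀ hφ]
  linarith

end SupportRecovery

end HeatFlow

end

theorem theorem2 {V : Type*} [Fintype V] [DecidableEq V] (G : SimpleGraph V) [DecidableRel G.Adj]
    (α : ℝ) (hα : 1 < α) :
    ∃ t₀ : ℝ, ∀ t : ℝ, t₀ ≤ t →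
      -- the linear model with fixed design and i.i.d. centred Gaussian noise
      ∀ {Ω : Type*} [MeasurableSpace Ω] (P : Measure Ω) [IsProbabilityMeasure P]
        (n : ℕ) (X : Matrix (Fin n) V ℝ) (βs : V → ℝ) (σ : ℝ≥0) (noise : Fin n → Ω → ℝ),
      (∀ i, Measurable (noise i)) → iIndepFun noise P →
      (∀ i, P.map (noise i) = gaussianReal 0 (σ ^ 2)) →
      -- the hypotheses of the bound on the estimation error
      ∀ (η lam ε : ℝ), 0 < η → η < 1 → 0 < lam → 0 < ε →
      2 * (σ : ℝ) / √(n : ℝ) * HeatFlow.noiseLevel G X η ≤ lam →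
      ∀ (ϖ κ : ℝ) (s : ℕ), 0 < ϖ → 0 < κ → 1 ≤ s →
      (HeatFlow.activeSet G βs).ncard ≤ s →
      HeatFlow.RestrictedEigenvalue G (3 + ϖ) s κ ((√(n : ℝ))⁻¹ • X) →
      -- the coherence assumption and the minimum signal condition
      ∀ (e : HeatFlow.GroupLabelling G) (φ : ℝ), 0 < φ →
      HeatFlow.BlockCoherence G X e s α φ →
      (∀ v, G.connectedComponentMk v ∈ HeatFlow.activeSet G βs →
        2 * HeatFlow.cConst α / φ * lam * √(HeatFlow.Tmax G : ℝ) < |βs v|) →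
      -- with probability at least `1 - 2kη`, every minimiser has the asserted properties
      ∃ E : Set Ω, MeasurableSet E ∧
        1 - 2 * (Nat.card G.ConnectedComponent : ℝ) * η ≤ P.real E ∧
        ∀ ω ∈ E, ∀ b ∈ HeatFlow.predBall X βs ε,
          IsMinOn (HeatFlow.objective G X (X *ᵥ βs + fun i => noise i ω) t lam)
            (HeatFlow.predBall X βs ε) b →
          (∀ v, G.connectedComponentMk v ∉ HeatFlow.activeSet G βs →
            |b v| ≤ HeatFlow.threshold G α φ lam) ∧
          (∀ v, G.connectedComponentMk v ∈ HeatFlow.activeSet G βs →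
            HeatFlow.threshold G α φ lam < |b v|) ∧
          {v | HeatFlow.threshold G α φ lam < |b v|} = {v | βs v ≠ 0} := by
  -- With `γ = 3` the coherence error would have constant `12 / (7(α - 1))`; the room up to 16
  -- permits `γ > 3`, hence `r < 1`. The `γ` chosen gives equality in the last condition, and `r`
  -- solves `(2r - 1) γ = 3`. Both depend on `α` alone, so `t₀` depends only on `G` and `α`.
  obtain ⟨γ, r, hγ, hr, hr0, hr1, hγα⟩ : ∃ γ r : ℝ, 3 < γ ∧ (2 * r - 1) * γ = 3 ∧ 0 ≤ r ∧ r < 1 ∧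
      42 * (1 + γ) * (α - 1) ≤ 16 * (14 * α - 2 - 4 * γ) := by
    have h0 : 0 < 21 * α + 11 := by linarith
    have h1 : 0 < 28 * (α - 1) / (21 * α + 11) := div_pos (by linarith) h0
    have h2 : 28 * (α - 1) / (21 * α + 11) * (21 * α + 11) = 28 * (α - 1) := by field_simp
    have hγ0 : 0 < 3 + 28 * (α - 1) / (21 * α + 11) := by linarith
    refine ⟨3 + 28 * (α - 1) / (21 * α + 11), (1 + 3 / (3 + 28 * (α - 1) / (21 * α + 11))) / 2,
      by linarith, ?_, by positivity, ?_, by linarith⟩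
    · rw [mul_div_cancel₀ _ two_ne_zero, add_sub_cancel_left, div_mul_cancel₀ _ hγ0.ne']
    · have h3 : 3 / (3 + 28 * (α - 1) / (21 * α + 11)) < 1 := by
        rw [div_lt_one hγ0]; linarith
      linarith
  obtain ⟨t₀, ht₀⟩ := HeatFlow.exists_le_heatKernel G (r := r ^ 2) (by nlinarith)
  refine ⟨t₀, fun t ht Ω _ P _ n X βs σ noise hmeas hindep hlaw η lam ε hη hη1 hlam hε hnoise
    ϖ κ s _ _ hs hA _ e φ hφ hX hsignal => ?_⟩
  obtain ⟨E, hE, hPE, hEb⟩ :=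
    HeatFlow.exists_noise_event G P X σ noise hmeas hindep hlaw hη hη1 hlam hnoise
  refine ⟨E, hE, le_trans ?_ hPE, fun ω hω b hb hmin => ?_⟩
  · have : 0 ≤ (Nat.card G.ConnectedComponent : ℝ) * η := by positivity
    linarith
  have herr := HeatFlow.abs_error_le G hα hφ hlam hε hγ hr hγα (ht₀ t ht) hs hA hX (hEb ω hω) hb hmin
  have hthr : 0 ≤ HeatFlow.threshold G α φ lam := by
    have : 0 < α - 1 := by linarith
    unfold HeatFlow.threshold HeatFlow.cConst
    positivity
  have hsignal' : ∀ v, G.connectedComponentMk v ∈ HeatFlow.activeSet G βs →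
      2 * HeatFlow.threshold G α φ lam < |βs v| := by
    intro v hv
    refine lt_of_eq_of_lt ?_ (hsignal v hv)
    rw [HeatFlow.threshold]
    ring
  have hoff : ∀ v, G.connectedComponentMk v ∉ HeatFlow.activeSet G βs →
      |b v| ≤ HeatFlow.threshold G α φ lam := by
    intro v hv
    simpa [HeatFlow.eq_zero_of_notMem_activeSet G hv] using herr v
  have hon : ∀ v, G.connectedComponentMk v ∈ HeatFlow.activeSet G βs →
      HeatFlow.threshold G α φ lam < |b v| := by
    intro v hv
    have h1 := hsignal' v hv
    have h2 := herr v
    have h3 := abs_sub_abs_le_abs_sub (βs v) (b v)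
    rw [abs_sub_comm] at h3
    linarith
  refine ⟨hoff, hon, ?_⟩
  ext v
  -- The signal condition makes every coordinate of an active group nonzero, so the support is
  -- exactly the union of the active groups.
  by_cases hv : G.connectedComponentMk v ∈ HeatFlow.activeSet G βs
  · have h1 : βs v ≠ 0 := abs_pos.1 (by linarith [hsignal' v hv])
    simp [hon v hv, h1]
  · simp [(hoff v hv).not_gt, HeatFlow.eq_zero_of_notMem_activeSet G hv]
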